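/- A polygon is a subset $P$ of $\mathbb{R}^2$ with non-empty interior that is the intersection of finitely many closed half-planes (so $P$ is convex and may be unbounded); its edges are its one-dimensional faces. For integers $m,k\ge 1$ let $N(m,k)$ be the least $n$ such that for every polygon $P$ with exactly $m$ edges there are real polynomials $p_1,\dots,p_n$ in two variables, each of degree at most $k$, with $\operatorname{int}P=\{x\in\mathbb{R}^2 : p_1(x)>0,\dots,p_n(x)>0\}$. Let $\overline N(m,k)$ be the least $n$ such that for every polygon $P$ with exactly $m$ edges there are real polynomials $p_1,\dots,p_n$ in two variables, each of degree at most $k$, with $P=\{x\in\mathbb{R}^2 : p_1(x)\ge 0,\dots,p_n(x)\ge 0\}$. (Both minima exist.) There is a sequence $(\varepsilon_m)$ of real numbers with $\varepsilon_m\to 0$ as $m\to\infty$ such that for all integers $m\ge 2$ and $k\ge 1$ with $k\le m/\log_2 m$, $$\frac mk\le N(m,k)\le(1+\varepsilon_m)\frac mk\qquad\text{and}\qquad \frac mk\le\overline N(m,k)\le(1+\varepsilon_m)\frac mk .$$ -/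

import Mathlib

/-- A polygon: a subset of `ℝ²` with non-empty interior that is the intersection of finitely many
closed half-planes `{x | ⟨a i, x⟩ ≤ b i}` with `a i ≠ 0`. It may be unbounded.
(The plane is `Fin 2 → ℝ`; only its affine structure and its topology are used.) -/
def IsPolygon (P : Set (Fin 2 → ℝ)) : Prop :=
  (∃ (r : ℕ) (a : Fin r → Fin 2 → ℝ) (b : Fin r → ℝ),
    (∀ i, a i ≠ 0) ∧ P = {x | ∀ i, dotProduct (a i) x ≤ b i}) ∧
  (interior P).Nonempty

/-- The edges of `P`: its one-dimensional faces, a face being the set of maximizers over `P` of a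
linear functional. -/
def edges (P : Set (Fin 2 → ℝ)) : Set (Set (Fin 2 → ℝ)) :=
  {I | IsExposed ℝ P I ∧ Module.finrank ℝ (vectorSpan ℝ I) = 1}

/-- The numbers `n` such that the interior of every polygon with `m` edges is described by `n` strict
inequalities `p i > 0` with real polynomials `p i` of degree at most `k`. -/
def openAdmissible (m k : ℕ) : Set ℕ :=
  {n | ∀ P : Set (Fin 2 → ℝ), IsPolygon P → (edges P).encard = m →
    ∃ p : Fin n → MvPolynomial (Fin 2) ℝ,
      interior P = {x | ∀ i, 0 < MvPolynomial.eval x (p i)} ∧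
      ∀ i, (p i).totalDegree ≤ k}

/-- The numbers `n` such that every polygon with `m` edges is described by `n` non-strict
inequalities `p i ≥ 0` with real polynomials `p i` of degree at most `k`. -/
def closedAdmissible (m k : ℕ) : Set ℕ :=
  {n | ∀ P : Set (Fin 2 → ℝ), IsPolygon P → (edges P).encard = m →
    ∃ p : Fin n → MvPolynomial (Fin 2) ℝ,
      P = {x | ∀ i, 0 ≤ MvPolynomial.eval x (p i)} ∧
      ∀ i, (p i).totalDegree ≤ k}

/-- The least number of strict inequalities of degree at most `k` that suffices for the interiors of
all polygons with `m` edges. -/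
noncomputable def openNumber (m k : ℕ) : ℕ := sInf (openAdmissible m k)

/-- The least number of non-strict inequalities of degree at most `k` that suffices for all polygons
with `m` edges. -/
noncomputable def closedNumber (m k : ℕ) : ℕ := sInf (closedAdmissible m k)

/-!
# Describing polygons by few polynomials of bounded degree

*Lower bound.* In a description of a polygon or of its interior, each point in the relative interior
of an edge is a zero of one of the finitely many polynomials that are not identically zero. As an
edge is infinite, one of these polynomials vanishes on its whole line
(`IsIrredundant.exists_eval_eq_zero_on_line`). A polynomial of degree at most `k` that is not zero
vanishes on at most `k` edge lines (`IsIrredundant.card_le_totalDegree`), so `m ≤ n * k`.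

*From colourings to descriptions.* The polynomials for the upper bound are products of the affine
functions `b i - a i ⬝ᵥ x` of the edges over the classes of a colouring of the edges. Edge `0` forms
a class of its own. On the inner side of edge `0`, the other edges can be numbered such that the
edges violated at a point are consecutive, even when some of the edges through the point are added
(`IsIrredundant.exists_perm`). So if every interval contains some colour an odd number of times, then
at each point outside the polygon one of the polynomials is negative
(`IsOddColoring.nonneg_of_prod_nonneg`).
Such a colouring is a path in a hypercube without repeated vertices.

*Construction of colourings.* What remains is to find colourings of `m` places with about `m / k`
colours, each used at most `k` times. If `k` is bounded, then runs through `m / k` colours, separated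
by `k` colours that are used once, suffice (`isOddColoring_separatedColoring`). Otherwise a Gray code
is hidden among such runs (`isOddColoring_roundColoring`). Most colours are arranged in `q + 1` blocks
of size `h`. A round lists each block `τ` times, with a separator colour after each list, and then
flips one bit of a word of `q * h` bits, following the 2-adic valuation of the number of the round.
The bits are identified with the colours of the first `q` blocks, and the last block holds their
parities, so the word can be recovered when one block, the one currently being listed, is unknown.
Hence almost `2 ^ (q * h)` rounds are possible, which is enough as `m / k ≥ log₂ m`. Colours are used at most
`τ + 1` times per round, and all overheads vanish in the limit.
-/

/-! ### Polygons and their edges -/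

/-- The data `(a, b)` present `P` as an irredundant intersection of the half-planes
`{x | a i ⬝ᵥ x ≤ b i}`. Irredundancy is encoded by a point on each boundary line that lies strictly
inside all other half-planes. -/
structure IsIrredundant {r : ℕ} (a : Fin r → Fin 2 → ℝ) (b : Fin r → ℝ) (P : Set (Fin 2 → ℝ)) :
    Prop where
  ne_zero : ∀ i, a i ≠ 0
  eq_setOf : P = {x | ∀ i, a i ⬝ᵥ x ≤ b i}
  exists_center : ∃ o, ∀ i, a i ⬝ᵥ o < b i
  exists_witness : ∀ i, ∃ z, a i ⬝ᵥ z = b i ∧ ∀ j, j ≠ i → a j ⬝ᵥ z < b j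

theorem isOpen_setOf_forall_dotProduct_lt {r : ℕ} (a : Fin r → Fin 2 → ℝ) (b : Fin r → ℝ) :
    IsOpen {x : Fin 2 → ℝ | ∀ i, a i ⬝ᵥ x < b i} := by
  simp only [Set.ofPred_forall]
  refine isOpen_iInter_of_finite fun i => isOpen_lt ?_ continuous_const
  fun_prop

theorem interior_setOf_forall_dotProduct_le {r : ℕ} {a : Fin r → Fin 2 → ℝ} (b : Fin r → ℝ)
    (ha : ∀ i, a i ≠ 0) :
    interior {x : Fin 2 → ℝ | ∀ i, a i ⬝ᵥ x ≤ b i} = {x | ∀ i, a i ⬝ᵥ x < b i} := by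
  apply Set.Subset.antisymm
  · intro x hx i
    refine lt_of_le_of_ne (interior_subset hx i) fun h => ?_
    have hc : Continuous fun t : ℝ => x + t • a i := by fun_prop
    have hn : ∀ᶠ t in nhds (0 : ℝ), x + t • a i ∈ {x : Fin 2 → ℝ | ∀ i, a i ⬝ᵥ x ≤ b i} :=
      hc.continuousAt.eventually_mem (by simpa using mem_interior_iff_mem_nhds.1 hx)
    obtain ⟨ε, hε, hb⟩ := Metric.eventually_nhds_iff.1 hn
    have h1 := hb (y := ε / 2) (by simp [abs_of_pos hε, hε]) i
    have h2 : 0 < a i ⬝ᵥ a i := by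
      refine lt_of_le_of_ne (Finset.sum_nonneg fun j _ => mul_self_nonneg _) fun h0 => ha i ?_
      exact dotProduct_self_eq_zero.1 h0.symm
    rw [dotProduct_add, dotProduct_smul, smul_eq_mul] at h1
    nlinarith
  · exact interior_maximal (fun x hx i => (hx i).le) (isOpen_setOf_forall_dotProduct_lt a b)

theorem convex_setOf_forall_dotProduct_le {r : ℕ} (a : Fin r → Fin 2 → ℝ) (b : Fin r → ℝ) :
    Convex ℝ {x : Fin 2 → ℝ | ∀ i, a i ⬝ᵥ x ≤ b i} := by
  intro x hx y hy s t hs ht hst i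
  have h1 := hx i
  have h2 := hy i
  rw [dotProduct_add, dotProduct_smul, dotProduct_smul, smul_eq_mul, smul_eq_mul]
  have : b i = s * b i + t * b i := by rw [← add_mul, hst, one_mul]
  rw [this]
  gcongr

/-- Dropping redundant half-planes one at a time leaves an irredundant presentation. The witness on
the `i`-th line is where the segment from a point violating only the `i`-th inequality to an
interior point crosses that line. -/
theorem IsPolygon.exists_isIrredundant {P : Set (Fin 2 → ℝ)} (hP : IsPolygon P) :
    ∃ (r : ℕ) (a : Fin r → Fin 2 → ℝ) (b : Fin r → ℝ), IsIrredundant a b P := by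
  classical
  obtain ⟨hex, hint⟩ := hP
  have hspec := Nat.find_spec hex
  have hmin := fun {l} (hl : l < Nat.find hex) => Nat.find_min hex hl
  generalize Nat.find hex = r at hspec hmin
  obtain ⟨a, b, ha, rfl⟩ := hspec
  rw [interior_setOf_forall_dotProduct_le b ha] at hint
  obtain ⟨o, ho⟩ := hint
  refine ⟨r, a, b, ha, rfl, ⟨o, ho⟩, fun i => ?_⟩
  obtain ⟨y, hyi, hy⟩ : ∃ y, b i < a i ⬝ᵥ y ∧ ∀ j, j ≠ i → a j ⬝ᵥ y ≤ b j := by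
    by_contra! hno
    obtain _ | r := r
    · exact i.elim0
    refine hmin (Nat.lt_succ_self r) ⟨fun j => a (i.succAbove j), fun j => b (i.succAbove j),
      fun j => ha _, ?_⟩
    ext x
    refine ⟨fun hx j => hx _, fun hx j => ?_⟩
    by_contra hj
    obtain ⟨l, hl, hl'⟩ := hno x (by
      by_contra hi
      rcases eq_or_ne j i with rfl | hji
      · exact hj (not_lt.1 hi)
      · obtain ⟨l, rfl⟩ := Fin.exists_succAbove_eq hji
        exact hj (hx l))
    obtain ⟨l, rfl⟩ := Fin.exists_succAbove_eq hl
    exact absurd (hx l) (not_le.2 hl')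
  have hoi := ho i
  set s := (b i - a i ⬝ᵥ o) / (a i ⬝ᵥ y - a i ⬝ᵥ o) with hs
  have hd : 0 < a i ⬝ᵥ y - a i ⬝ᵥ o := by linarith
  have hs0 : 0 ≤ s := div_nonneg (by linarith) hd.le
  have hs1 : s < 1 := by rw [hs, div_lt_one hd]; linarith
  have hsd : s * (a i ⬝ᵥ y - a i ⬝ᵥ o) = b i - a i ⬝ᵥ o := div_mul_cancel₀ _ hd.ne'
  refine ⟨s • y + (1 - s) • o, ?_, fun j hj => ?_⟩
  · simp only [dotProduct_add, dotProduct_smul, smul_eq_mul]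
    linarith
  · simp only [dotProduct_add, dotProduct_smul, smul_eq_mul]
    have := hy j hj
    have := ho j
    nlinarith

/-- A nonzero vector orthogonal to `v`. -/
def perp (v : Fin 2 → ℝ) : Fin 2 → ℝ := ![v 1, -v 0]

theorem dotProduct_perp (v : Fin 2 → ℝ) : v ⬝ᵥ perp v = 0 := by
  simp [perp, dotProduct, Fin.sum_univ_two]; ring

theorem perp_ne_zero {v : Fin 2 → ℝ} (hv : v ≠ 0) : perp v ≠ 0 := by
  contrapose! hv
  have h0 := congrFun hv 0
  have h1 := congrFun hv 1
  simp [perp] at h0 h1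
  ext i
  fin_cases i <;> simpa

theorem exists_eq_smul_perp {v x : Fin 2 → ℝ} (hv : v ≠ 0) (h : v ⬝ᵥ x = 0) :
    ∃ t : ℝ, x = t • perp v := by
  simp only [dotProduct, Fin.sum_univ_two] at h
  have hv' : v 0 ≠ 0 ∨ v 1 ≠ 0 := by
    by_contra! hh
    exact hv (by ext i; fin_cases i <;> simp [hh])
  rcases hv' with h0 | h1
  · refine ⟨-x 1 / v 0, ?_⟩
    ext i
    fin_cases i
    · simp [perp]; field_simp; linarith
    · simp [perp]; field_simp
  · refine ⟨x 0 / v 1, ?_⟩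
    ext i
    fin_cases i
    · simp [perp]; field_simp
    · simp [perp]; field_simp; linarith

namespace IsIrredundant

variable {r : ℕ} {a : Fin r → Fin 2 → ℝ} {b : Fin r → ℝ} {P : Set (Fin 2 → ℝ)}

theorem interior_eq (h : IsIrredundant a b P) : interior P = {x | ∀ i, a i ⬝ᵥ x < b i} := by
  rw [h.eq_setOf, interior_setOf_forall_dotProduct_le b h.ne_zero]

theorem isPolygon (h : IsIrredundant a b P) : IsPolygon P :=
  ⟨⟨r, a, b, h.ne_zero, h.eq_setOf⟩, by rw [h.interior_eq]; exact h.exists_center⟩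

/-- Each edge line contains a whole segment of the polygon around the witness. -/
theorem exists_segment (h : IsIrredundant a b P) (i : Fin r) :
    ∃ z, (a i ⬝ᵥ z = b i ∧ ∀ j, j ≠ i → a j ⬝ᵥ z < b j) ∧ ∃ δ : ℝ, 0 < δ ∧
      ∀ t : ℝ, |t| < δ → z + t • perp (a i) ∈ P ∧ a i ⬝ᵥ (z + t • perp (a i)) = b i := by
  obtain ⟨z, hz, hz'⟩ := h.exists_witness i
  refine ⟨z, ⟨hz, hz'⟩, ?_⟩
  have hi : ∀ t : ℝ, a i ⬝ᵥ (z + t • perp (a i)) = b i := fun t => by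
    rw [dotProduct_add, dotProduct_smul, dotProduct_perp, hz]; simp
  have hev : ∀ᶠ t in nhds (0 : ℝ), ∀ j, j ≠ i → a j ⬝ᵥ (z + t • perp (a i)) < b j := by
    refine Filter.eventually_all.2 fun j => ?_
    by_cases hj : j = i
    · simp [hj]
    have hc : Continuous fun t : ℝ => a j ⬝ᵥ (z + t • perp (a i)) := by fun_prop
    filter_upwards [hc.continuousAt.eventually_lt continuousAt_const
      (by simpa using hz' j hj)] with t ht _ using ht
  obtain ⟨δ, hδ, hb⟩ := Metric.eventually_nhds_iff.1 hev
  refine ⟨δ, hδ, fun t ht => ⟨?_, hi t⟩⟩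
  rw [h.eq_setOf]
  intro j
  by_cases hj : j = i
  · rw [hj, hi]
  · exact (hb (by simpa using ht) j hj).le

theorem face_injective (h : IsIrredundant a b P) :
    Function.Injective fun i => {x ∈ P | a i ⬝ᵥ x = b i} := by
  intro i j hij
  by_contra hne
  obtain ⟨z, hz, hz'⟩ := h.exists_witness i
  have hzi : z ∈ {x ∈ P | a i ⬝ᵥ x = b i} := by
    refine ⟨?_, hz⟩
    rw [h.eq_setOf]
    intro l
    by_cases hl : l = i
    · rw [hl, hz]
    · exact (hz' l hl).le
  have hij' : {x ∈ P | a i ⬝ᵥ x = b i} = {x ∈ P | a j ⬝ᵥ x = b j} := hij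
  rw [hij'] at hzi
  exact (hz' j (Ne.symm hne)).ne hzi.2

theorem face_mem_edges (h : IsIrredundant a b P) (i : Fin r) :
    {x ∈ P | a i ⬝ᵥ x = b i} ∈ edges P := by
  obtain ⟨z, ⟨hz, hz'⟩, δ, hδ, hseg⟩ := h.exists_segment i
  have hz0 : z ∈ P := by simpa using (hseg 0 (by simpa using hδ)).1
  refine ⟨fun _ => ⟨LinearMap.toContinuousLinearMap
    (dotProductBilin ℝ ℝ (a i)), ?_⟩, ?_⟩
  · ext x
    simp only [Set.mem_ofPred_eq, LinearMap.coe_toContinuousLinearMap', dotProductBilin_apply_apply]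
    constructor
    · rintro ⟨hx, hxi⟩
      refine ⟨hx, fun y hy => ?_⟩
      rw [h.eq_setOf] at hy
      rw [hxi]
      exact hy i
    · rintro ⟨hx, hmax⟩
      refine ⟨hx, le_antisymm ?_ (hz ▸ hmax z hz0)⟩
      rw [h.eq_setOf] at hx
      exact hx i
  · have hspan : vectorSpan ℝ {x ∈ P | a i ⬝ᵥ x = b i} = Submodule.span ℝ {perp (a i)} := by
      apply le_antisymm
      · rw [vectorSpan_def, Submodule.span_le]
        rintro _ ⟨x, ⟨_, hx⟩, y, ⟨_, hy⟩, rfl⟩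
        obtain ⟨t, ht⟩ := exists_eq_smul_perp (x := x - y) (h.ne_zero i)
          (by rw [dotProduct_sub, hx, hy, sub_self])
        exact Submodule.mem_span_singleton.2 ⟨t, by simpa using ht.symm⟩
      · rw [Submodule.span_singleton_le_iff_mem]
        have h2 := hseg (δ / 2) (by rw [abs_of_pos (by linarith)]; linarith)
        have := vsub_mem_vectorSpan ℝ (s := {x ∈ P | a i ⬝ᵥ x = b i}) h2 ⟨hz0, hz⟩
        simp only [vsub_eq_sub, add_sub_cancel_left] at this
        exact (Submodule.smul_mem_iff _ (by linarith : δ / 2 ≠ 0)).1 this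
    rw [hspan, finrank_span_singleton (perp_ne_zero (h.ne_zero i))]

theorem exists_face_of_mem_edges (h : IsIrredundant a b P) {I : Set (Fin 2 → ℝ)}
    (hI : I ∈ edges P) : ∃ i, I = {x ∈ P | a i ⬝ᵥ x = b i} := by
  obtain ⟨hexp, hdim⟩ := hI
  have hnt : ∃ x ∈ I, ∃ y ∈ I, x ≠ y := by
    by_contra! hsub
    have : I.Subsingleton := fun x hx y hy => hsub x hx y hy
    rw [(vectorSpan_eq_bot_iff_subsingleton (k := ℝ)).2 this] at hdim
    simp at hdim
  obtain ⟨x, hx, y, hy, hxy⟩ := hnt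
  obtain ⟨f, hf⟩ := hexp ⟨x, hx⟩
  have hsub : I ⊆ P := hf ▸ fun x hx => hx.1
  have hxP := hsub hx
  have hyP := hsub hy
  have hfxy : f x = f y := by
    rw [hf] at hx hy
    exact le_antisymm (hy.2 x hxP) (hx.2 y hyP)
  set w := (2⁻¹ : ℝ) • (x + y) with hw
  have hfw : f w = f x := by
    rw [hw, map_smul, map_add, ← hfxy, smul_eq_mul]; ring
  -- The midpoint lies on some line: in the interior it would force `f = 0` and `I = P`.
  have hbd : ∃ i, a i ⬝ᵥ w = b i := by
    by_contra! hno
    have hwint : w ∈ interior P := by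
      rw [h.interior_eq]
      intro i
      refine lt_of_le_of_ne ?_ (hno i)
      rw [h.eq_setOf] at hxP hyP
      have h1 := hxP i
      have h2 := hyP i
      rw [hw, dotProduct_smul, dotProduct_add, smul_eq_mul]
      linarith
    have hmax : IsLocalMax f w := by
      filter_upwards [mem_interior_iff_mem_nhds.1 hwint] with u hu
      rw [hfw]
      rw [hf] at hx
      exact hx.2 u hu
    have hf0 : f = 0 := by
      have := hmax.fderiv_eq_zero
      rwa [f.fderiv] at this
    have hIP : I = P := by rw [hf, hf0]; simp
    have htop : vectorSpan ℝ P = ⊤ := by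
      have := (isOpen_interior (s := P)).affineSpan_eq_top ⟨w, hwint⟩
      have h2 : affineSpan ℝ P = ⊤ := top_le_iff.1 (this ▸ affineSpan_mono ℝ interior_subset)
      rw [← direction_affineSpan, h2, AffineSubspace.direction_top]
    rw [hIP, htop] at hdim
    simp at hdim
  obtain ⟨i, hi⟩ := hbd
  have hxy' : a i ⬝ᵥ x = b i ∧ a i ⬝ᵥ y = b i := by
    rw [h.eq_setOf] at hxP hyP
    have h1 := hxP i
    have h2 := hyP i
    rw [hw, dotProduct_smul, dotProduct_add, smul_eq_mul] at hi
    constructor <;> linarith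
  obtain ⟨t, ht⟩ := exists_eq_smul_perp (x := x - y) (h.ne_zero i)
    (by rw [dotProduct_sub, hxy'.1, hxy'.2, sub_self])
  have ht0 : t ≠ 0 := by
    rintro rfl
    exact hxy (sub_eq_zero.1 (by simpa using ht))
  have hfp : f (perp (a i)) = 0 := by
    have := congrArg f ht
    rw [map_sub, map_smul, hfxy, sub_self, smul_eq_mul] at this
    exact (mul_eq_zero.1 this.symm).resolve_left ht0
  refine ⟨i, Set.Subset.antisymm (fun u hu => ⟨hsub hu, ?_⟩) ?_⟩
  · have hle : Submodule.span ℝ {x - y} ≤ vectorSpan ℝ I := by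
      rw [Submodule.span_singleton_le_iff_mem]
      exact vsub_mem_vectorSpan ℝ hx hy
    have heq : Submodule.span ℝ {x - y} = vectorSpan ℝ I :=
      Submodule.eq_of_le_of_finrank_eq hle
        (by rw [hdim, finrank_span_singleton (sub_ne_zero.2 hxy)])
    have hmem := vsub_mem_vectorSpan ℝ hu hx
    rw [← heq, Submodule.mem_span_singleton] at hmem
    obtain ⟨s, hs⟩ := hmem
    have : u = x + s • (x - y) := by rw [hs]; simp
    rw [this, dotProduct_add, dotProduct_smul, dotProduct_sub, hxy'.1, hxy'.2]
    simp
  · rintro u ⟨huP, hu⟩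
    obtain ⟨s, hs⟩ := exists_eq_smul_perp (x := u - x) (h.ne_zero i)
      (by rw [dotProduct_sub, hu, hxy'.1, sub_self])
    have hfu : f u = f x := by
      have := congrArg f hs
      rw [map_sub, map_smul, hfp, smul_zero] at this
      exact sub_eq_zero.1 this
    rw [hf] at hx ⊢
    exact ⟨huP, fun v hv => hfu ▸ hx.2 v hv⟩

theorem encard_edges (h : IsIrredundant a b P) : (edges P).encard = r := by
  have : edges P = Set.range fun i => {x ∈ P | a i ⬝ᵥ x = b i} := by
    ext I
    constructor
    · intro hI
      obtain ⟨i, rfl⟩ := h.exists_face_of_mem_edges hI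
      exact ⟨i, rfl⟩
    · rintro ⟨i, rfl⟩
      exact h.face_mem_edges i
  rw [this, ← Set.image_univ, h.face_injective.encard_image, Set.encard_univ]
  simp

end IsIrredundant

/-- A polygon with `m` edges has an irredundant presentation by exactly `m` half-planes. -/
theorem IsPolygon.exists_isIrredundant_of_encard {P : Set (Fin 2 → ℝ)} {m : ℕ} (hP : IsPolygon P)
    (hm : (edges P).encard = m) :
    ∃ (a : Fin m → Fin 2 → ℝ) (b : Fin m → ℝ), IsIrredundant a b P := by
  obtain ⟨r, a, b, h⟩ := hP.exists_isIrredundant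
  obtain rfl : r = m := by
    have := h.encard_edges
    rw [hm] at this
    exact_mod_cast this.symm
  exact ⟨a, b, h⟩

/-- The region above the tangents of the parabola `y = x²` at `0, …, m - 1` has `m` edges. -/
theorem exists_isPolygon_encard_edges (m : ℕ) :
    ∃ P : Set (Fin 2 → ℝ), IsPolygon P ∧ (edges P).encard = m := by
  have h : IsIrredundant (fun j : Fin m => ![2 * (j : ℝ), -1]) (fun j : Fin m => (j : ℝ) ^ 2)
      {x | ∀ j : Fin m, ![2 * (j : ℝ), -1] ⬝ᵥ x ≤ (j : ℝ) ^ 2} := by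
    refine ⟨fun i h0 => ?_, rfl, ⟨![0, 1], fun i => ?_⟩,
      fun i => ⟨![(i : ℝ), (i : ℝ) ^ 2], ?_, fun j hj => ?_⟩⟩
    · have := congrFun h0 1
      simp at this
    · simp [dotProduct, Fin.sum_univ_two]
      nlinarith [sq_nonneg (i : ℝ)]
    · simp [dotProduct, Fin.sum_univ_two]
      ring
    · have hne : (j : ℝ) - i ≠ 0 := by
        rw [sub_ne_zero]
        exact_mod_cast Fin.val_ne_of_ne hj
      simp [dotProduct, Fin.sum_univ_two]
      nlinarith [sq_pos_of_ne_zero hne]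
  exact ⟨_, h.isPolygon, h.encard_edges⟩

/-! ### At most `k` edge lines lie in the zero set of a polynomial of degree `k` -/

open Polynomial in
/-- The restriction of a bivariate polynomial to the line `t ↦ y + t • d`. -/
noncomputable def restrictLine (p : MvPolynomial (Fin 2) ℝ) (y d : Fin 2 → ℝ) : ℝ[X] :=
  MvPolynomial.aeval (fun i => C (y i) + C (d i) * X) p

theorem eval_restrictLine (p : MvPolynomial (Fin 2) ℝ) (y d : Fin 2 → ℝ) (t : ℝ) :
    (restrictLine p y d).eval t = MvPolynomial.eval (y + t • d) p := by
  rw [restrictLine, ← Polynomial.coe_evalRingHom, MvPolynomial.map_aeval, MvPolynomial.eval]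
  congr 2
  · exact Subsingleton.elim _ _
  · funext i
    rw [map_add, map_mul, Polynomial.coe_evalRingHom, Polynomial.eval_C, Polynomial.eval_C,
      Polynomial.eval_X, Pi.add_apply, Pi.smul_apply, smul_eq_mul, mul_comm]

theorem natDegree_restrictLine_le (p : MvPolynomial (Fin 2) ℝ) (y d : Fin 2 → ℝ) :
    (restrictLine p y d).natDegree ≤ p.totalDegree := by
  have := MvPolynomial.aeval_natDegree_le p le_rfl
    (fun i => Polynomial.C (y i) + Polynomial.C (d i) * Polynomial.X) (n := 1) fun i => by
      compute_degree
  simpa [restrictLine] using this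

theorem exists_forall_dotProduct_ne_zero {ι : Type*} (s : Finset ι) (v : ι → Fin 2 → ℝ)
    (hv : ∀ i ∈ s, v i ≠ 0) : ∃ d : Fin 2 → ℝ, ∀ i ∈ s, v i ⬝ᵥ d ≠ 0 := by
  classical
  obtain ⟨t, ht⟩ := Infinite.exists_notMem_finset (s.image fun i => -v i 0 / v i 1)
  refine ⟨![1, t], fun i hi h0 => ?_⟩
  simp only [dotProduct, Fin.sum_univ_two, Matrix.cons_val_zero, Matrix.cons_val_one, mul_one] at h0
  by_cases h1 : v i 1 = 0
  · refine hv i hi ?_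
    ext j
    fin_cases j
    · simpa [h1] using h0
    · simpa using h1
  · refine ht (Finset.mem_image.2 ⟨i, hi, ?_⟩)
    field_simp
    linarith

namespace IsIrredundant

variable {m : ℕ} {a : Fin m → Fin 2 → ℝ} {b : Fin m → ℝ} {P : Set (Fin 2 → ℝ)}

/-- A polynomial that is not identically zero vanishes on at most as many edge lines as its degree:
restrict it to a line through a non-zero that meets all these edge lines in distinct points. -/
theorem card_le_totalDegree (h : IsIrredundant a b P) (p : MvPolynomial (Fin 2) ℝ)
    {y : Fin 2 → ℝ} (hy : MvPolynomial.eval y p ≠ 0) (s : Finset (Fin m))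
    (hs : ∀ i ∈ s, ∀ x, a i ⬝ᵥ x = b i → MvPolynomial.eval x p = 0) :
    s.card ≤ p.totalDegree := by
  have hoff : ∀ i ∈ s, b i - a i ⬝ᵥ y ≠ 0 := fun i hi h0 => hy (hs i hi y (by linarith))
  -- The parameters of the intersection points of lines `i` and `j` differ iff `d` is not
  -- orthogonal to this vector.
  obtain ⟨d, hd⟩ := exists_forall_dotProduct_ne_zero (s ×ˢ s)
    (fun ij => if ij.1 = ij.2 then a ij.1 else
      (b ij.1 - a ij.1 ⬝ᵥ y) • a ij.2 - (b ij.2 - a ij.2 ⬝ᵥ y) • a ij.1) (by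
    rintro ⟨i, j⟩ hij
    obtain ⟨hi, hj⟩ := Finset.mem_product.1 hij
    by_cases hne : i = j
    · simpa [hne] using h.ne_zero j
    · simp only [hne, if_false]
      intro h0
      obtain ⟨z, hz, hz'⟩ := h.exists_witness i
      have h1 : ((b i - a i ⬝ᵥ y) • a j - (b j - a j ⬝ᵥ y) • a i) ⬝ᵥ (z - y) = 0 := by
        rw [h0, zero_dotProduct]
      simp only [sub_dotProduct, smul_dotProduct, dotProduct_sub, smul_eq_mul, hz] at h1
      have h2 : (b i - a i ⬝ᵥ y) * (a j ⬝ᵥ z - b j) = 0 := by linarith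
      rcases mul_eq_zero.1 h2 with h3 | h3
      · exact hoff i hi h3
      · have := hz' j (Ne.symm hne)
        linarith)
  have hdi : ∀ i ∈ s, a i ⬝ᵥ d ≠ 0 := fun i hi => by
    simpa using hd (i, i) (Finset.mem_product.2 ⟨hi, hi⟩)
  have hne : restrictLine p y d ≠ 0 := by
    intro h0
    have := eval_restrictLine p y d 0
    rw [h0] at this
    exact hy (by simpa using this.symm)
  set t : Fin m → ℝ := fun i => (b i - a i ⬝ᵥ y) / (a i ⬝ᵥ d) with ht
  have hinj : Set.InjOn t s := by
    intro i hi j hj hij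
    by_contra hne
    have h1 := hd (i, j) (Finset.mem_product.2 ⟨hi, hj⟩)
    simp only [hne, if_false, sub_dotProduct, smul_dotProduct, smul_eq_mul] at h1
    simp only [ht] at hij
    rw [div_eq_div_iff (hdi i hi) (hdi j hj)] at hij
    exact h1 (by linarith)
  have hroots : s.image t ⊆ (restrictLine p y d).roots.toFinset := by
    intro u hu
    obtain ⟨i, hi, rfl⟩ := Finset.mem_image.1 hu
    rw [Multiset.mem_toFinset, Polynomial.mem_roots hne, Polynomial.IsRoot, eval_restrictLine]
    refine hs i hi _ ?_
    have := hdi i hi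
    rw [dotProduct_add, dotProduct_smul, smul_eq_mul, ht]
    field_simp
    ring
  calc s.card = (s.image t).card := (Finset.card_image_of_injOn hinj).symm
    _ ≤ (restrictLine p y d).roots.toFinset.card := Finset.card_le_card hroots
    _ ≤ (restrictLine p y d).roots.card := Multiset.toFinset_card_le _
    _ ≤ (restrictLine p y d).natDegree := Polynomial.card_roots' _
    _ ≤ p.totalDegree := natDegree_restrictLine_le p y d

/-- If each boundary point is a zero of one of the nonzero polynomials among the `p j`, then each
edge line is contained in the zero set of one of them. -/
theorem exists_eval_eq_zero_on_line (h : IsIrredundant a b P) {n : ℕ}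
    (p : Fin n → MvPolynomial (Fin 2) ℝ)
    (hp : ∀ w ∈ P, w ∉ interior P →
      ∃ j, MvPolynomial.eval w (p j) = 0 ∧ ∃ y, MvPolynomial.eval y (p j) ≠ 0) (i : Fin m) :
    ∃ j, (∃ y, MvPolynomial.eval y (p j) ≠ 0) ∧
      ∀ x, a i ⬝ᵥ x = b i → MvPolynomial.eval x (p j) = 0 := by
  obtain ⟨z, ⟨hz, -⟩, δ, hδ, hseg⟩ := h.exists_segment i
  have hj : ∀ t ∈ Set.Ioo (-δ) δ, ∃ j, MvPolynomial.eval (z + t • perp (a i)) (p j) = 0 ∧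
      ∃ y, MvPolynomial.eval y (p j) ≠ 0 := fun t ht => by
    obtain ⟨h1, h2⟩ := hseg t (abs_lt.2 ht)
    refine hp _ h1 fun h3 => ?_
    rw [h.interior_eq] at h3
    exact (h3 i).ne h2
  choose f hf hf' using fun t : Set.Ioo (-δ) δ => hj t t.2
  have : Infinite (Set.Ioo (-δ) δ) := (Set.Ioo_infinite (show -δ < δ by linarith)).to_subtype
  obtain ⟨j, hinf⟩ := Finite.exists_infinite_fiber f
  obtain ⟨⟨t₀, ht₀⟩⟩ := hinf.nonempty
  refine ⟨j, ht₀ ▸ hf' t₀, fun x hx => ?_⟩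
  have hzero : restrictLine (p j) z (perp (a i)) = 0 := by
    refine Polynomial.eq_zero_of_infinite_isRoot _ ?_
    refine ((Set.infinite_coe_iff.1 hinf).image Subtype.val_injective.injOn).mono ?_
    rintro _ ⟨t, rfl, rfl⟩
    rw [Set.mem_ofPred_eq, Polynomial.IsRoot, eval_restrictLine]
    exact hf t
  obtain ⟨t, ht⟩ := exists_eq_smul_perp (x := x - z) (h.ne_zero i)
    (by rw [dotProduct_sub, hx, hz, sub_self])
  have := eval_restrictLine (p j) z (perp (a i)) t
  rw [hzero, ← ht] at this
  simpa using this.symm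

theorem le_mul_of_forall_boundary (h : IsIrredundant a b P) {n k : ℕ}
    (p : Fin n → MvPolynomial (Fin 2) ℝ) (hdeg : ∀ j, (p j).totalDegree ≤ k)
    (hp : ∀ w ∈ P, w ∉ interior P →
      ∃ j, MvPolynomial.eval w (p j) = 0 ∧ ∃ y, MvPolynomial.eval y (p j) ≠ 0) :
    m ≤ n * k := by
  choose f hf hf' using h.exists_eval_eq_zero_on_line p hp
  have hfib : ∀ j : Fin n, (Finset.univ.filter fun i => f i = j).card ≤ k := fun j => by
    rcases (Finset.univ.filter fun i => f i = j).eq_empty_or_nonempty with h0 | ⟨i, hi⟩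
    · simp [h0]
    obtain ⟨y, hy⟩ := hf i
    rw [(Finset.mem_filter.1 hi).2] at hy
    refine (h.card_le_totalDegree (p j) hy _ fun l hl => ?_).trans (hdeg j)
    rw [← (Finset.mem_filter.1 hl).2]
    exact hf' l
  have h2 := Finset.card_le_mul_card_image_of_maps_to (s := Finset.univ) (t := Finset.univ)
    (f := f) (fun _ _ => Finset.mem_univ _) k fun j _ => hfib j
  simpa [mul_comm] using h2

theorem le_mul_of_interior_eq (h : IsIrredundant a b P) {n k : ℕ}
    (p : Fin n → MvPolynomial (Fin 2) ℝ) (hdeg : ∀ j, (p j).totalDegree ≤ k)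
    (hp : interior P = {x | ∀ j, 0 < MvPolynomial.eval x (p j)}) : m ≤ n * k := by
  refine h.le_mul_of_forall_boundary p hdeg fun w hwP hw => ?_
  obtain ⟨o, ho⟩ := h.exists_center
  have hoi : o ∈ interior P := by rw [h.interior_eq]; exact ho
  have hconv : Convex ℝ P := by rw [h.eq_setOf]; exact convex_setOf_forall_dotProduct_le a b
  have hcl : w ∈ closure (interior P) := by
    rw [hconv.closure_interior_eq_closure_of_nonempty_interior ⟨o, hoi⟩]
    exact subset_closure hwP
  obtain ⟨j, hj⟩ : ∃ j, MvPolynomial.eval w (p j) ≤ 0 := by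
    by_contra! hno
    exact hw (by rw [hp]; exact hno)
  refine ⟨j, le_antisymm hj ?_, o, ?_⟩
  · have hclosed : IsClosed {x | 0 ≤ MvPolynomial.eval x (p j)} :=
      isClosed_le continuous_const (p j).continuous_eval
    refine closure_minimal (fun x hx => ?_) hclosed hcl
    rw [hp] at hx
    exact (hx j).le
  · rw [hp] at hoi
    exact (hoi j).ne'

theorem le_mul_of_eq (h : IsIrredundant a b P) {n k : ℕ}
    (p : Fin n → MvPolynomial (Fin 2) ℝ) (hdeg : ∀ j, (p j).totalDegree ≤ k)
    (hp : P = {x | ∀ j, 0 ≤ MvPolynomial.eval x (p j)}) : m ≤ n * k := by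
  refine h.le_mul_of_forall_boundary p hdeg fun w hwP hw => ?_
  have hfreq : ∃ᶠ x in nhds w, ∃ j, MvPolynomial.eval x (p j) < 0 := by
    intro hno
    refine hw (mem_interior_iff_mem_nhds.2 ?_)
    filter_upwards [hno] with x hx
    rw [hp]
    intro j
    by_contra hj
    exact hx ⟨j, not_le.1 hj⟩
  obtain ⟨j, hj⟩ := Filter.frequently_exists.1 hfreq
  refine ⟨j, le_antisymm ?_ ?_, ?_⟩
  · by_contra hpos
    have : ∀ᶠ x in nhds w, 0 < MvPolynomial.eval x (p j) :=
      (p j).continuous_eval.continuousAt.eventually_const_lt (not_le.1 hpos)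
    obtain ⟨x, hx, hx'⟩ := (hj.and_eventually this).exists
    linarith
  · rw [hp] at hwP
    exact hwP j
  · obtain ⟨y, hy⟩ := hj.exists
    exact ⟨y, hy.ne⟩

end IsIrredundant

/-! ### From colourings to polynomial descriptions -/

/-- A colouring `c` of `0, …, m - 1` that uses each colour at most `k` times and in which every
nonempty interval contains some colour an odd number of times. Equivalently, `c` lists the
directions of a path with `m` steps in a hypercube that visits no vertex twice and uses each
direction at most `k` times. -/
structure IsOddColoring {κ : Type*} [DecidableEq κ] (m k : ℕ) (c : ℕ → κ) : Prop where
  card_le : ∀ j, ((Finset.range m).filter fun i => c i = j).card ≤ k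
  exists_odd : ∀ p q, p < q → q ≤ m → ∃ j, Odd ((Finset.Ico p q).filter fun i => c i = j).card

theorem IsOddColoring.mono {κ : Type*} [DecidableEq κ] {m m' k : ℕ} {c : ℕ → κ}
    (hc : IsOddColoring m' k c) (hm : m ≤ m') : IsOddColoring m k c where
  card_le j := le_trans (Finset.card_le_card (Finset.filter_subset_filter _
    (Finset.range_subset_range.2 hm))) (hc.card_le j)
  exists_odd p q hpq hq := hc.exists_odd p q hpq (hq.trans hm)

theorem prod_neg_of_odd_card_filter {ι : Type*} (s : Finset ι) (f : ι → ℝ) (hf : ∀ i ∈ s, f i ≠ 0)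
    (hodd : Odd (s.filter fun i => f i < 0).card) : ∏ i ∈ s, f i < 0 := by
  have h1 : ∏ i ∈ s, f i = ∏ i ∈ s, (if f i < 0 then -1 else 1) * |f i| := by
    refine Finset.prod_congr rfl fun i _ => ?_
    split_ifs with h
    · rw [abs_of_neg h]; ring
    · rw [abs_of_nonneg (not_lt.1 h)]; ring
  rw [h1, Finset.prod_mul_distrib, Finset.prod_ite, Finset.prod_const, Finset.prod_const,
    one_pow, mul_one, hodd.neg_one_pow]
  have : 0 < ∏ i ∈ s, |f i| := Finset.prod_pos fun i hi => abs_pos.2 (hf i hi)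
  linarith

/-- If some value were negative, the negative indices together with one zero index from each colour
class with an odd number of negative indices would form an interval containing each colour an even
number of times. -/
theorem IsOddColoring.nonneg_of_prod_nonneg {κ : Type*} [DecidableEq κ] {m k : ℕ} {c : ℕ → κ}
    (hc : IsOddColoring m k c) (f : ℕ → ℝ)
    (hf : ∀ i j l, i < j → j < l → l < m → f i ≤ 0 → f l ≤ 0 → f j < 0)
    (hprod : ∀ j, 0 ≤ ∏ i ∈ (Finset.range m).filter (fun i => c i = j), f i) :
    ∀ i < m, 0 ≤ f i := by
  classical
  by_contra! hneg
  obtain ⟨i₀, hi₀, hf₀⟩ := hneg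
  set O : κ → Prop := fun j =>
    Odd (((Finset.range m).filter fun i => c i = j).filter fun i => f i < 0).card with hO
  have hz : ∀ j, ∃ z, O j → z < m ∧ c z = j ∧ f z = 0 := by
    intro j
    by_cases hj : O j
    · by_contra! hno
      refine absurd (hprod j) (not_le.2 (prod_neg_of_odd_card_filter _ _ (fun i hi h0 => ?_) hj))
      obtain ⟨hi1, hi2⟩ := Finset.mem_filter.1 hi
      exact (hno i).2 (Finset.mem_range.1 hi1) hi2 h0
    · exact ⟨0, fun h => absurd h hj⟩
  choose z hz using hz
  set W := (Finset.range m).filter fun i => f i < 0 ∨ (O (c i) ∧ i = z (c i)) with hW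
  have hmem : ∀ i, i ∈ W ↔ i < m ∧ (f i < 0 ∨ (O (c i) ∧ i = z (c i))) := fun i => by
    rw [hW, Finset.mem_filter, Finset.mem_range]
  have hWle : ∀ i ∈ W, f i ≤ 0 := by
    intro i hi
    obtain ⟨-, h | ⟨h1, h2⟩⟩ := (hmem i).1 hi
    · exact h.le
    · rw [h2, (hz _ h1).2.2]
  have hne : W.Nonempty := ⟨i₀, (hmem _).2 ⟨hi₀, Or.inl hf₀⟩⟩
  have hIco : Finset.Ico (W.min' hne) (W.max' hne + 1) = W := by
    ext i
    rw [Finset.mem_Ico, Nat.lt_succ_iff]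
    constructor
    · rintro ⟨h1, h2⟩
      rcases h1.eq_or_lt with h1 | h1
      · rw [← h1]; exact W.min'_mem hne
      rcases h2.eq_or_lt with h2 | h2
      · rw [h2]; exact W.max'_mem hne
      have hlt := ((hmem _).1 (W.max'_mem hne)).1
      exact (hmem i).2 ⟨h2.trans hlt, Or.inl (hf _ i _ h1 h2 hlt (hWle _ (W.min'_mem hne))
        (hWle _ (W.max'_mem hne)))⟩
    · exact fun hi => ⟨W.min'_le i hi, W.le_max' i hi⟩
  obtain ⟨j, hj⟩ := hc.exists_odd (W.min' hne) (W.max' hne + 1)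
    (Nat.lt_succ_of_le (W.min'_le _ (W.max'_mem hne))) ((hmem _).1 (W.max'_mem hne)).1
  rw [hIco] at hj
  by_cases hOj : O j
  · have hins : (W.filter fun i => c i = j) = insert (z j)
        (((Finset.range m).filter fun i => c i = j).filter fun i => f i < 0) := by
      obtain ⟨hz1, hz2, hz3⟩ := hz j hOj
      ext i
      simp only [Finset.mem_filter, hmem, Finset.mem_insert, Finset.mem_range]
      constructor
      · rintro ⟨⟨h1, h2 | ⟨h2, h3⟩⟩, h4⟩
        · exact Or.inr ⟨⟨h1, h4⟩, h2⟩
        · exact Or.inl (by rw [h3, h4])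
      · rintro (rfl | ⟨⟨h1, h2⟩, h3⟩)
        · exact ⟨⟨hz1, Or.inr (by rw [hz2]; exact ⟨hOj, rfl⟩)⟩, hz2⟩
        · exact ⟨⟨h1, Or.inl h3⟩, h2⟩
    rw [hins, Finset.card_insert_of_notMem (by simp [(hz j hOj).2.2])] at hj
    exact (Nat.not_even_iff_odd.2 hj) hOj.add_one
  · refine hOj ?_
    have heq : (W.filter fun i => c i = j) =
        (((Finset.range m).filter fun i => c i = j).filter fun i => f i < 0) := by
      ext i
      simp only [Finset.mem_filter, hmem, Finset.mem_range]
      constructor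
      · rintro ⟨⟨h1, h2 | ⟨h2, h3⟩⟩, h4⟩
        · exact ⟨⟨h1, h4⟩, h2⟩
        · exact absurd (h4 ▸ h2) hOj
      · rintro ⟨⟨h1, h2⟩, h3⟩
        exact ⟨⟨h1, Or.inl h3⟩, h2⟩
    rw [heq] at hj
    exact hj

theorem IsOddColoring.pos_of_prod_pos {κ : Type*} [DecidableEq κ] {m k : ℕ} {c : ℕ → κ}
    (hc : IsOddColoring m k c) (f : ℕ → ℝ)
    (hf : ∀ i j l, i < j → j < l → l < m → f i ≤ 0 → f l ≤ 0 → f j < 0)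
    (hprod : ∀ j, 0 < ∏ i ∈ (Finset.range m).filter (fun i => c i = j), f i) :
    ∀ i < m, 0 < f i := by
  intro i hi
  refine lt_of_le_of_ne (hc.nonneg_of_prod_nonneg f hf (fun j => (hprod j).le) i hi) fun h0 => ?_
  exact (hprod (c i)).ne' (Finset.prod_eq_zero (Finset.mem_filter.2 ⟨Finset.mem_range.2 hi, rfl⟩)
    h0.symm)

namespace IsIrredundant

variable {m : ℕ} {a : Fin (m + 1) → Fin 2 → ℝ} {b : Fin (m + 1) → ℝ} {P : Set (Fin 2 → ℝ)}

/-- Coordinates adapted to edge `0`: `u = b 0 - a 0 ⬝ᵥ x` is the distance to its line up to scaling,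
and on that line all other constraints are positive at the witness, hence can be normalized to
`1 + t * s i`. -/
theorem exists_normal_form (h : IsIrredundant a b P) :
    ∃ s c w : Fin m → ℝ, (∀ i, 0 < w i) ∧ ∀ x, ∃ t : ℝ, ∀ i : Fin m,
      b i.succ - a i.succ ⬝ᵥ x = w i * (1 + t * s i + (b 0 - a 0 ⬝ᵥ x) * c i) := by
  obtain ⟨z, hz, hz'⟩ := h.exists_witness 0
  have hw : ∀ i : Fin m, 0 < b i.succ - a i.succ ⬝ᵥ z := fun i =>
    sub_pos.2 (hz' _ (Fin.succ_ne_zero i))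
  have haa : a 0 ⬝ᵥ a 0 ≠ 0 := fun h0 => h.ne_zero 0 (dotProduct_self_eq_zero.1 h0)
  refine ⟨fun i => -(a i.succ ⬝ᵥ perp (a 0)) / (b i.succ - a i.succ ⬝ᵥ z),
    fun i => (a i.succ ⬝ᵥ a 0) / (a 0 ⬝ᵥ a 0) / (b i.succ - a i.succ ⬝ᵥ z),
    fun i => b i.succ - a i.succ ⬝ᵥ z, hw, fun x => ?_⟩
  obtain ⟨t, ht⟩ := exists_eq_smul_perp (h.ne_zero 0)
    (x := x - z + ((b 0 - a 0 ⬝ᵥ x) / (a 0 ⬝ᵥ a 0)) • a 0) (by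
      rw [dotProduct_add, dotProduct_smul, dotProduct_sub, hz, smul_eq_mul]
      field_simp
      ring)
  refine ⟨t, fun i => ?_⟩
  have hi := congrArg (fun v => a i.succ ⬝ᵥ v) ht
  simp only [dotProduct_add, dotProduct_sub, dotProduct_smul, smul_eq_mul] at hi
  have := (hw i).ne'
  field_simp
  field_simp at hi
  linarith

/-- After a suitable numbering of the edges other than edge `0`, the constraints violated at a point
on the inner side of edge `0` form an interval, and only its two neighbours can be tight. In the
coordinates of `exists_normal_form` the edges are ordered by `s i`; irredundancy makes `c i` a
strictly convex function of `s i`. -/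
theorem exists_perm (h : IsIrredundant a b P) :
    ∃ σ : Equiv.Perm (Fin m), ∀ x, a 0 ⬝ᵥ x ≤ b 0 → ∀ i j l : Fin m, i < j → j < l →
      b (σ i).succ - a (σ i).succ ⬝ᵥ x ≤ 0 → b (σ l).succ - a (σ l).succ ⬝ᵥ x ≤ 0 →
      b (σ j).succ - a (σ j).succ ⬝ᵥ x < 0 := by
  obtain ⟨s, c, w, hw, hform⟩ := h.exists_normal_form
  -- The values of the normalized constraints at the witness of edge `i + 1`.
  have hwit : ∀ i : Fin m, ∃ t u : ℝ, 0 < u ∧ 1 + t * s i + u * c i = 0 ∧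
      ∀ j, j ≠ i → 0 < 1 + t * s j + u * c j := by
    intro i
    obtain ⟨z, hz, hz'⟩ := h.exists_witness i.succ
    obtain ⟨t, ht⟩ := hform z
    refine ⟨t, b 0 - a 0 ⬝ᵥ z, sub_pos.2 (hz' 0 (Fin.succ_ne_zero i).symm), ?_, fun j hj => ?_⟩
    · have := ht i
      rw [hz, sub_self] at this
      exact (mul_eq_zero.1 this.symm).resolve_left (hw i).ne'
    · have h1 := hz' j.succ (fun h => hj (Fin.succ_injective _ h))
      have h2 := ht j
      exact pos_of_mul_pos_right (h2 ▸ sub_pos.2 h1) (hw j).le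
  have hinj : Function.Injective s := by
    intro i j hij
    by_contra hne
    obtain ⟨t, u, hu, h1, h2⟩ := hwit i
    obtain ⟨t', u', hu', h1', h2'⟩ := hwit j
    have h3 := h2 j (Ne.symm hne)
    have h3' := h2' i hne
    rw [hij] at h1 h3'
    have h4 : 0 < u * (c j - c i) := by linarith
    have h4' : 0 < u' * (c i - c j) := by linarith
    have h5 := pos_of_mul_pos_right h4 hu.le
    have h5' := pos_of_mul_pos_right h4' hu'.le
    linarith
  have hmono : StrictMono (s ∘ Tuple.sort s) :=
    (Tuple.monotone_sort s).strictMono_of_injective (hinj.comp (Equiv.injective _))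
  refine ⟨Tuple.sort s, fun x hx i j l hij hjl hi hl => ?_⟩
  have hsij : s (Tuple.sort s i) < s (Tuple.sort s j) := hmono hij
  have hsjl : s (Tuple.sort s j) < s (Tuple.sort s l) := hmono hjl
  have hij' : Tuple.sort s i ≠ Tuple.sort s j := fun h => hsij.ne (congrArg s h)
  have hlj' : Tuple.sort s l ≠ Tuple.sort s j := fun h => hsjl.ne' (congrArg s h)
  generalize Tuple.sort s i = i at *
  generalize Tuple.sort s j = j at *
  generalize Tuple.sort s l = l at *
  have hκ : (s l - s i) * c j - (s l - s j) * c i - (s j - s i) * c l < 0 := by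
    obtain ⟨t, u, hu, h1, h2⟩ := hwit j
    have h3 := mul_pos (sub_pos.2 hsjl) (h2 i hij')
    have h4 := mul_pos (sub_pos.2 hsij) (h2 l hlj')
    have h5 : 0 < u * -((s l - s i) * c j - (s l - s j) * c i - (s j - s i) * c l) := by
      linear_combination h3 + h4 + (s l - s i) * h1
    have := pos_of_mul_pos_right h5 hu.le
    linarith
  obtain ⟨t, ht⟩ := hform x
  have hu : 0 ≤ b 0 - a 0 ⬝ᵥ x := sub_nonneg.2 hx
  rw [ht] at hi hl ⊢
  generalize b 0 - a 0 ⬝ᵥ x = u at *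
  have hi' := nonpos_of_mul_nonpos_right hi (hw i)
  have hl' := nonpos_of_mul_nonpos_right hl (hw l)
  refine mul_neg_of_pos_of_neg (hw j) ?_
  have key : (s l - s i) * (1 + t * s j + u * c j) =
      (s l - s j) * (1 + t * s i + u * c i) + (s j - s i) * (1 + t * s l + u * c l) +
      u * ((s l - s i) * c j - (s l - s j) * c i - (s j - s i) * c l) := by ring
  have h1 : (s l - s j) * (1 + t * s i + u * c i) ≤ 0 :=
    mul_nonpos_of_nonneg_of_nonpos (by linarith) hi'
  have h2 : (s j - s i) * (1 + t * s l + u * c l) ≤ 0 :=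
    mul_nonpos_of_nonneg_of_nonpos (by linarith) hl'
  have hneg : (s l - s i) * (1 + t * s j + u * c j) < 0 := by
    rcases hu.eq_or_lt with rfl | hu
    · -- On the line of edge `0` the values `1 + t * s i` and `1 + t * s l` cannot both vanish.
      rw [key, zero_mul, add_zero]
      refine lt_of_le_of_ne (by linarith) fun h0 => ?_
      have e1 : (s l - s j) * (1 + t * s i + 0 * c i) = 0 := by linarith
      have e2 : (s j - s i) * (1 + t * s l + 0 * c l) = 0 := by linarith
      have e1' := (mul_eq_zero.1 e1).resolve_left (by linarith)
      have e2' := (mul_eq_zero.1 e2).resolve_left (by linarith)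
      have e3 : t * (s l - s i) = 0 := by linarith
      have e4 := (mul_eq_zero.1 e3).resolve_right (by linarith)
      rw [e4] at e1'
      linarith
    · have := mul_neg_of_pos_of_neg hu hκ
      linarith
  exact neg_of_mul_neg_right hneg (by linarith)

end IsIrredundant

/-- The affine function `x ↦ b - a ⬝ᵥ x` as a polynomial. -/
noncomputable def affinePolynomial (a : Fin 2 → ℝ) (b : ℝ) : MvPolynomial (Fin 2) ℝ :=
  MvPolynomial.C b - (MvPolynomial.C (a 0) * MvPolynomial.X 0 +
    MvPolynomial.C (a 1) * MvPolynomial.X 1)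

theorem eval_affinePolynomial (a : Fin 2 → ℝ) (b : ℝ) (x : Fin 2 → ℝ) :
    MvPolynomial.eval x (affinePolynomial a b) = b - a ⬝ᵥ x := by
  simp [affinePolynomial, dotProduct, Fin.sum_univ_two]

theorem totalDegree_affinePolynomial_le (a : Fin 2 → ℝ) (b : ℝ) :
    (affinePolynomial a b).totalDegree ≤ 1 := by
  have hX : ∀ (r : ℝ) (i : Fin 2),
      (MvPolynomial.C r * MvPolynomial.X i : MvPolynomial (Fin 2) ℝ).totalDegree ≤ 1 := fun r i =>
    (MvPolynomial.totalDegree_mul _ _).trans (by simp)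
  refine (MvPolynomial.totalDegree_sub _ _).trans (max_le (by simp) ?_)
  exact (MvPolynomial.totalDegree_add _ _).trans (max_le (hX _ _) (hX _ _))

/-- An odd colouring with colours in `K` turns a polygon with `m + 1` edges into a description by
`#K + 1` polynomials: the affine function of edge `0`, and the products of the affine functions of
the other edges over the colour classes. The same polynomials serve the polygon and its interior. -/
theorem IsIrredundant.exists_description {κ : Type*} [DecidableEq κ] {m k : ℕ}
    {a : Fin (m + 1) → Fin 2 → ℝ} {b : Fin (m + 1) → ℝ} {P : Set (Fin 2 → ℝ)}
    (h : IsIrredundant a b P) {c : ℕ → κ} (hc : IsOddColoring m k c) (K : Finset κ)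
    (hK : ∀ i < m, c i ∈ K) (hk : 1 ≤ k) :
    ∃ p : Fin (K.card + 1) → MvPolynomial (Fin 2) ℝ,
      interior P = {x | ∀ i, 0 < MvPolynomial.eval x (p i)} ∧
      P = {x | ∀ i, 0 ≤ MvPolynomial.eval x (p i)} ∧ ∀ i, (p i).totalDegree ≤ k := by
  obtain ⟨σ, hσ⟩ := h.exists_perm
  set g : ℕ → MvPolynomial (Fin 2) ℝ := fun i =>
    if hi : i < m then affinePolynomial (a (σ ⟨i, hi⟩).succ) (b (σ ⟨i, hi⟩).succ) else 0 with hg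
  have hgev : ∀ (x : Fin 2 → ℝ) (i : ℕ) (hi : i < m), MvPolynomial.eval x (g i) =
      b (σ ⟨i, hi⟩).succ - a (σ ⟨i, hi⟩).succ ⬝ᵥ x := fun x i hi => by
    simp only [hg, hi, dite_true, eval_affinePolynomial]
  have hgdeg : ∀ i, (g i).totalDegree ≤ 1 := fun i => by
    simp only [hg]
    split_ifs
    · exact totalDegree_affinePolynomial_le _ _
    · simp
  set q : κ → MvPolynomial (Fin 2) ℝ := fun j =>
    ∏ i ∈ (Finset.range m).filter (fun i => c i = j), g i with hq
  have hqev : ∀ x j, MvPolynomial.eval x (q j) =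
      ∏ i ∈ (Finset.range m).filter (fun i => c i = j), MvPolynomial.eval x (g i) := fun x j => by
    simp only [hq, map_prod]
  have hqdeg : ∀ j, (q j).totalDegree ≤ k := fun j => by
    refine (MvPolynomial.totalDegree_finsetProd _ _).trans ((Finset.sum_le_card_nsmul _ _ 1
      fun i _ => hgdeg i).trans ?_)
    simpa using hc.card_le j
  have hqone : ∀ j, j ∉ K → q j = 1 := fun j hj => by
    refine Finset.prod_eq_one fun i hi => ?_
    obtain ⟨h1, h2⟩ := Finset.mem_filter.1 hi
    exact absurd (h2 ▸ hK i (Finset.mem_range.1 h1)) hj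
  have hsplit : ∀ Q : Fin (m + 1) → Prop, (∀ i, Q i) ↔
      Q 0 ∧ ∀ i (hi : i < m), Q (σ ⟨i, hi⟩).succ := fun Q => by
    rw [Fin.forall_fin_succ]
    refine and_congr_right fun _ => ⟨fun hQ i hi => hQ _, fun hQ i => ?_⟩
    simpa using hQ (σ.symm i) (σ.symm i).2
  have hord : ∀ x, a 0 ⬝ᵥ x ≤ b 0 → ∀ i j l, i < j → j < l → l < m →
      MvPolynomial.eval x (g i) ≤ 0 → MvPolynomial.eval x (g l) ≤ 0 →
      MvPolynomial.eval x (g j) < 0 := fun x hx i j l hij hjl hl => by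
    have hj := hjl.trans hl
    rw [hgev x i (hij.trans hj), hgev x j hj, hgev x l hl]
    exact hσ x hx _ _ _ hij hjl
  have hKall : ∀ R : MvPolynomial (Fin 2) ℝ → Prop, R 1 →
      ((∀ j : Fin K.card, R (q (K.equivFin.symm j))) ↔ ∀ j, R (q j)) := fun R hR => by
    refine ⟨fun hj j => ?_, fun hj j => hj _⟩
    by_cases hjK : j ∈ K
    · simpa using hj (K.equivFin ⟨j, hjK⟩)
    · rw [hqone j hjK]; exact hR
  refine ⟨Fin.cons (affinePolynomial (a 0) (b 0)) fun j => q (K.equivFin.symm j), ?_, ?_, ?_⟩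
  · rw [h.interior_eq]
    ext x
    rw [Set.mem_ofPred_eq, Set.mem_ofPred_eq, hsplit, Fin.forall_fin_succ]
    simp only [Fin.cons_zero, Fin.cons_succ]
    rw [eval_affinePolynomial, sub_pos, hKall (fun p => 0 < MvPolynomial.eval x p) (by simp)]
    refine and_congr_right fun h0 => ⟨fun hx j => ?_, fun hx i hi => ?_⟩
    · rw [hqev]
      refine Finset.prod_pos fun i hi => ?_
      have hi' := Finset.mem_range.1 (Finset.mem_filter.1 hi).1
      rw [hgev x i hi']
      exact sub_pos.2 (hx i hi')
    · have := hc.pos_of_prod_pos _ (hord x h0.le) (fun j => hqev x j ▸ hx j) i hi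
      rw [hgev x i hi] at this
      exact sub_pos.1 this
  · rw [h.eq_setOf]
    ext x
    rw [Set.mem_ofPred_eq, Set.mem_ofPred_eq, hsplit, Fin.forall_fin_succ]
    simp only [Fin.cons_zero, Fin.cons_succ]
    rw [eval_affinePolynomial, sub_nonneg, hKall (fun p => 0 ≤ MvPolynomial.eval x p) (by simp)]
    refine and_congr_right fun h0 => ⟨fun hx j => ?_, fun hx i hi => ?_⟩
    · rw [hqev]
      refine Finset.prod_nonneg fun i hi => ?_
      have hi' := Finset.mem_range.1 (Finset.mem_filter.1 hi).1
      rw [hgev x i hi']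
      exact sub_nonneg.2 (hx i hi')
    · have := hc.nonneg_of_prod_nonneg _ (hord x h0) (fun j => hqev x j ▸ hx j) i hi
      rw [hgev x i hi] at this
      exact sub_nonneg.1 this
  · refine Fin.cases ?_ fun j => ?_
    · exact (totalDegree_affinePolynomial_le _ _).trans hk
    · exact hqdeg _

theorem IsOddColoring.mem_admissible {κ : Type*} [DecidableEq κ] {m k : ℕ} {c : ℕ → κ}
    (hc : IsOddColoring m k c) (K : Finset κ) (hK : ∀ i < m, c i ∈ K) (hm : 1 ≤ m) (hk : 1 ≤ k) :
    K.card + 1 ∈ openAdmissible m k ∧ K.card + 1 ∈ closedAdmissible m k := by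
  obtain ⟨m, rfl⟩ : ∃ m', m = m' + 1 := ⟨m - 1, by omega⟩
  have hc' := hc.mono (Nat.le_succ m)
  constructor <;> intro P hP hcard <;>
    obtain ⟨a, b, h⟩ := hP.exists_isIrredundant_of_encard hcard <;>
    obtain ⟨p, hp1, hp2, hp3⟩ := h.exists_description hc' K (fun i hi => hK i (by omega)) hk
  · exact ⟨p, hp1, hp3⟩
  · exact ⟨p, hp2, hp3⟩

/-! ### Two constructions of colourings -/

theorem Finset.sum_range_mul_add_eq (f : ℕ → ℕ) (w u i : ℕ) :
    ∑ t ∈ Finset.range (u * w + i), f t =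
      ∑ u' ∈ Finset.range u, ∑ i' ∈ Finset.range w, f (u' * w + i') +
        ∑ i' ∈ Finset.range i, f (u * w + i') := by
  rw [Finset.sum_range_add]
  congr 1
  induction u with
  | zero => simp
  | succ u ih => rw [Nat.succ_mul, Finset.sum_range_add, ih, Finset.sum_range_succ]

/-- Runs through the colours `(0, 0), …, (0, h - 1)` again and again, separated by colours
`(1, 0), (1, 1), …` that are used only once. -/
def separatedColoring (h t : ℕ) : ℕ × ℕ :=
  if t % (h + 1) = h then (1, t / (h + 1)) else (0, t % (h + 1))

theorem isOddColoring_separatedColoring (h k : ℕ) :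
    IsOddColoring (k * (h + 1)) k (separatedColoring h) where
  card_le j := by
    rw [← Finset.card_range k]
    refine Finset.card_le_card_of_injOn (fun t => t / (h + 1)) (fun t ht => ?_)
      fun t ht t' ht' htt => ?_
    · have := (Finset.mem_filter.1 ht).1
      rw [Finset.mem_range, Finset.card_range] at this
      exact Finset.mem_coe.2 (Finset.mem_range.2 ((Nat.div_lt_iff_lt_mul (Nat.succ_pos h)).2 this))
    · have h1 := (Finset.mem_filter.1 ht).2
      rw [← (Finset.mem_filter.1 ht').2] at h1
      have htt : t / (h + 1) = t' / (h + 1) := htt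
      have hmod : t % (h + 1) = t' % (h + 1) := by
        unfold separatedColoring at h1
        split_ifs at h1 with e1 e2 e2
        · rw [e1, e2]
        · simp at h1
        · simp at h1
        · simpa using h1
      rw [← Nat.div_add_mod t (h + 1), ← Nat.div_add_mod t' (h + 1), htt, hmod]
  exists_odd p q hpq hq := by
    have hsingle : ∀ t ∈ Finset.Ico p q,
        (∀ t' ∈ Finset.Ico p q, separatedColoring h t' = separatedColoring h t → t' = t) →
        ∃ j, Odd ((Finset.Ico p q).filter fun i => separatedColoring h i = j).card := by
      intro t ht huniq
      refine ⟨separatedColoring h t, ?_⟩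
      have : ((Finset.Ico p q).filter fun i => separatedColoring h i = separatedColoring h t) =
          {t} := by
        ext t'
        rw [Finset.mem_filter, Finset.mem_singleton]
        exact ⟨fun h' => huniq t' h'.1 h'.2, by rintro rfl; exact ⟨ht, rfl⟩⟩
      rw [this]
      simp
    by_cases hsep : ∃ t ∈ Finset.Ico p q, t % (h + 1) = h
    · obtain ⟨t, ht, hth⟩ := hsep
      refine hsingle t ht fun t' _ heq => ?_
      unfold separatedColoring at heq
      rw [if_pos hth] at heq
      split_ifs at heq with e
      · have hdiv : t' / (h + 1) = t / (h + 1) := by simpa using heq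
        rw [← Nat.div_add_mod t (h + 1), ← Nat.div_add_mod t' (h + 1), hdiv, hth, e]
      · simp at heq
    · push Not at hsep
      refine hsingle p (Finset.mem_Ico.2 ⟨le_rfl, hpq⟩) fun t ht heq => ?_
      have hp := hsep p (Finset.mem_Ico.2 ⟨le_rfl, hpq⟩)
      unfold separatedColoring at heq
      rw [if_neg (hsep t ht), if_neg hp] at heq
      have hmod : t % (h + 1) = p % (h + 1) := by simpa using heq
      have ht' := Finset.mem_Ico.1 ht
      rcases (Nat.div_le_div_right (c := h + 1) ht'.1).eq_or_lt with hdiv | hdiv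
      · rw [← Nat.div_add_mod t (h + 1), ← Nat.div_add_mod p (h + 1), hdiv, hmod]
      · -- The separator ending the block of `p` would lie between `p` and `t`.
        exfalso
        have e1 := Nat.div_add_mod p (h + 1)
        have e2 := Nat.div_add_mod t (h + 1)
        have e3 : p % (h + 1) < h + 1 := Nat.mod_lt p (Nat.succ_pos h)
        have e4 : (h + 1) * (p / (h + 1) + 1) ≤ (h + 1) * (t / (h + 1)) :=
          Nat.mul_le_mul_left _ hdiv
        refine hsep ((h + 1) * (p / (h + 1)) + h) (Finset.mem_Ico.2 ⟨by omega, ?_⟩) ?_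
        · rw [Nat.mul_add] at e4
          omega
        · rw [Nat.mul_add_mod, Nat.mod_eq_of_lt (Nat.lt_succ_self h)]

/-- In an interval of positive integers the maximal 2-adic valuation is attained exactly once. -/
theorem exists_card_filter_padicValNat_eq_one {p q : ℕ} (hpq : p < q) :
    ∃ v, ((Finset.Ico p q).filter fun n => padicValNat 2 (n + 1) = v).card = 1 := by
  obtain ⟨n, hn, hmax⟩ := Finset.exists_max_image (Finset.Ico p q) (fun n => padicValNat 2 (n + 1))
    ⟨p, Finset.mem_Ico.2 ⟨le_rfl, hpq⟩⟩
  have key : ∀ n n' : ℕ, n ∈ Finset.Ico p q → n' ∈ Finset.Ico p q → n < n' →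
      padicValNat 2 (n' + 1) = padicValNat 2 (n + 1) →
      ∃ l ∈ Finset.Ico p q, padicValNat 2 (n + 1) < padicValNat 2 (l + 1) := by
    intro n n' hn hn' hlt heq
    obtain ⟨o, ho⟩ : 2 ^ padicValNat 2 (n + 1) ∣ n + 1 := pow_padicValNat_dvd
    obtain ⟨o', ho'⟩ : 2 ^ padicValNat 2 (n + 1) ∣ n' + 1 := heq ▸ pow_padicValNat_dvd
    have hodd : ¬ 2 ∣ o := by
      rintro ⟨o₂, rfl⟩
      have := pow_succ_padicValNat_not_dvd (p := 2) (Nat.succ_ne_zero n)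
      exact this ⟨o₂, by rw [pow_succ, mul_assoc]; exact ho⟩
    have hodd' : ¬ 2 ∣ o' := by
      rintro ⟨o₂, rfl⟩
      have := pow_succ_padicValNat_not_dvd (p := 2) (Nat.succ_ne_zero n')
      exact this ⟨o₂, by rw [heq, pow_succ, mul_assoc]; exact ho'⟩
    generalize padicValNat 2 (n + 1) = v at *
    have hpos : 0 < 2 ^ v := by positivity
    have hoo : o < o' := by
      have : 2 ^ v * o < 2 ^ v * o' := by omega
      exact lt_of_mul_lt_mul_left' this
    have h2 : 2 ^ v * (o + 1) < 2 ^ v * o' := Nat.mul_lt_mul_of_pos_left (by omega) hpos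
    rw [Finset.mem_Ico] at hn hn'
    refine ⟨2 ^ v * (o + 1) - 1, Finset.mem_Ico.2 ⟨?_, ?_⟩, ?_⟩
    · rw [Nat.mul_add]; omega
    · omega
    · have h3 : 2 ^ v * (o + 1) - 1 + 1 = 2 ^ v * (o + 1) := Nat.sub_add_cancel (Nat.succ_le_of_lt (by positivity))
      rw [h3, Nat.lt_iff_add_one_le, ← padicValNat_dvd_iff_le (by positivity), pow_succ]
      exact Nat.mul_dvd_mul_left _ (by omega)
  refine ⟨padicValNat 2 (n + 1), Finset.card_eq_one.2 ⟨n, ?_⟩⟩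
  ext n'
  rw [Finset.mem_filter, Finset.mem_singleton]
  refine ⟨fun ⟨hn', heq⟩ => ?_, by rintro rfl; exact ⟨hn, rfl⟩⟩
  by_contra hne
  rcases Nat.lt_or_gt_of_ne hne with hlt | hlt
  · obtain ⟨l, hl, hl'⟩ := key n' n hn' hn hlt heq.symm
    exact absurd (hmax l hl) (by omega)
  · obtain ⟨l, hl, hl'⟩ := key n n' hn hn' hlt heq
    exact absurd (hmax l hl) (by omega)

/-- The colour at place `i ≤ h` of segment `s ≤ (q + 1) * τ` of round `R`. Each segment ends with
its own separator colour `(q + 2, s)`. In segments `s < (q + 1) * τ` the `h` colours of block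
`s % (q + 1)` are listed once. The last segment of a round begins with the data colour encoding
`v = padicValNat 2 (R + 1)` in the blocks `0, …, q - 1` and the parity colour `v % h` in block `q`;
the rest is filled with colours of block `q + 1`. -/
def roundColor (q τ h R s i : ℕ) : ℕ × ℕ :=
  if i = h then (q + 2, s)
  else if s < (q + 1) * τ then (s % (q + 1), i)
  else if i = 0 then (padicValNat 2 (R + 1) / h, padicValNat 2 (R + 1) % h)
  else if i = 1 then (q, padicValNat 2 (R + 1) % h)
  else (q + 1, i)

/-- The concatenation of the rounds described by `roundColor`, each of `(q + 1) * τ + 1` segments of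
length `h + 1`. -/
def roundColoring (q τ h t : ℕ) : ℕ × ℕ :=
  roundColor q τ h (t / (h + 1) / ((q + 1) * τ + 1)) (t / (h + 1) % ((q + 1) * τ + 1)) (t % (h + 1))

theorem roundColoring_eq {q τ h R s i : ℕ} (hs : s ≤ (q + 1) * τ) (hi : i ≤ h) :
    roundColoring q τ h ((R * ((q + 1) * τ + 1) + s) * (h + 1) + i) = roundColor q τ h R s i := by
  have h1 : ((R * ((q + 1) * τ + 1) + s) * (h + 1) + i) / (h + 1) = R * ((q + 1) * τ + 1) + s := by
    rw [mul_comm, Nat.mul_add_div (Nat.succ_pos h), Nat.div_eq_of_lt (Nat.lt_succ_of_le hi),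
      add_zero]
  have h2 : ((R * ((q + 1) * τ + 1) + s) * (h + 1) + i) % (h + 1) = i := by
    rw [mul_comm, Nat.mul_add_mod, Nat.mod_eq_of_lt (Nat.lt_succ_of_le hi)]
  have h3 : (R * ((q + 1) * τ + 1) + s) / ((q + 1) * τ + 1) = R := by
    rw [mul_comm, Nat.mul_add_div (Nat.succ_pos _), Nat.div_eq_of_lt (Nat.lt_succ_of_le hs),
      add_zero]
  have h4 : (R * ((q + 1) * τ + 1) + s) % ((q + 1) * τ + 1) = s := by
    rw [mul_comm R, Nat.mul_add_mod, Nat.mod_eq_of_lt (Nat.lt_succ_of_le hs)]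
  rw [roundColoring, h1, h2, h3, h4]

/-- The number of occurrences of colour `j` among the first `i` places of a segment. -/
def segCount (q τ h : ℕ) (j : ℕ × ℕ) (R s i : ℕ) : ℕ :=
  ∑ i' ∈ Finset.range i, if roundColor q τ h R s i' = j then 1 else 0

/-- The number of occurrences of colour `j` in the segments before the last one of a round. It is
the same in each round. -/
def lapCount (q τ h : ℕ) (j : ℕ × ℕ) (s : ℕ) : ℕ :=
  ∑ s' ∈ Finset.range s, segCount q τ h j 0 s' (h + 1)

theorem segCount_eq_of_lt {q τ h : ℕ} (j : ℕ × ℕ) (R R' : ℕ) {s : ℕ} (i : ℕ)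
    (hs : s < (q + 1) * τ) : segCount q τ h j R s i = segCount q τ h j R' s i := by
  simp only [segCount, roundColor, if_pos hs]

theorem card_filter_roundColoring {q τ h : ℕ} (j : ℕ × ℕ) (R : ℕ) {s i : ℕ}
    (hs : s ≤ (q + 1) * τ) (hi : i ≤ h) :
    ((Finset.range ((R * ((q + 1) * τ + 1) + s) * (h + 1) + i)).filter
      fun t => roundColoring q τ h t = j).card =
    R * lapCount q τ h j ((q + 1) * τ) +
      ∑ R' ∈ Finset.range R, segCount q τ h j R' ((q + 1) * τ) (h + 1) +
      lapCount q τ h j s + segCount q τ h j R s i := by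
  have hseg : ∀ R s i, s ≤ (q + 1) * τ → i ≤ h + 1 → ∑ i' ∈ Finset.range i,
      (if roundColoring q τ h ((R * ((q + 1) * τ + 1) + s) * (h + 1) + i') = j then 1 else 0) =
      segCount q τ h j R s i := by
    intro R s i hs hi
    refine Finset.sum_congr rfl fun i' hi' => ?_
    rw [roundColoring_eq hs (by have := Finset.mem_range.1 hi'; omega)]
  have hlap : ∀ R s, s ≤ (q + 1) * τ → ∑ s' ∈ Finset.range s, segCount q τ h j R s' (h + 1) =
      lapCount q τ h j s := by
    intro R s hs
    refine Finset.sum_congr rfl fun s' hs' => segCount_eq_of_lt _ _ _ _ ?_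
    exact (Finset.mem_range.1 hs').trans_le hs
  rw [Finset.card_filter, Finset.sum_range_mul_add_eq, Finset.sum_range_mul_add_eq,
    hseg R s i hs (by omega)]
  have h1 : ∀ R', ∑ s' ∈ Finset.range ((q + 1) * τ + 1), ∑ i' ∈ Finset.range (h + 1),
      (if roundColoring q τ h ((R' * ((q + 1) * τ + 1) + s') * (h + 1) + i') = j then 1 else 0) =
      lapCount q τ h j ((q + 1) * τ) + segCount q τ h j R' ((q + 1) * τ) (h + 1) := by
    intro R'
    rw [Finset.sum_range_succ, hseg R' _ _ le_rfl le_rfl, ← hlap R' _ le_rfl]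
    congr 1
    refine Finset.sum_congr rfl fun s' hs' => hseg R' s' _ ?_ le_rfl
    exact (Finset.mem_range.1 hs').le
  have h2 : ∑ s' ∈ Finset.range s, ∑ i' ∈ Finset.range (h + 1),
      (if roundColoring q τ h ((R * ((q + 1) * τ + 1) + s') * (h + 1) + i') = j then 1 else 0) =
      lapCount q τ h j s := by
    rw [← hlap R s hs]
    refine Finset.sum_congr rfl fun s' hs' => hseg R s' _ ?_ le_rfl
    exact ((Finset.mem_range.1 hs').trans_le hs).le
  rw [h2, Finset.sum_congr rfl fun R' _ => h1 R', Finset.sum_add_distrib, Finset.sum_const,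
    Finset.card_range, smul_eq_mul]

theorem roundColor_injective {q τ h R s : ℕ} (hv : padicValNat 2 (R + 1) < q * h) :
    Function.Injective (roundColor q τ h R s) := by
  have hq : padicValNat 2 (R + 1) / h < q := Nat.div_lt_of_lt_mul (by rwa [mul_comm])
  have hq' : s % (q + 1) < q + 1 := Nat.mod_lt _ (Nat.succ_pos q)
  intro i i' heq
  unfold roundColor at heq
  split_ifs at heq <;> simp only [Prod.mk.injEq] at heq <;> omega

theorem segCount_roundColor {q τ h R s i i' : ℕ} (hv : padicValNat 2 (R + 1) < q * h) :
    segCount q τ h (roundColor q τ h R s i) R s i' = if i < i' then 1 else 0 := by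
  simp only [segCount, (roundColor_injective hv).eq_iff, Finset.sum_ite_eq', Finset.mem_range]

theorem segCount_le_one {q τ h R s i : ℕ} (j : ℕ × ℕ) (hv : padicValNat 2 (R + 1) < q * h) :
    segCount q τ h j R s i ≤ 1 := by
  rw [segCount, ← Finset.card_filter, Finset.card_le_one]
  intro i₁ h1 i₂ h2
  exact roundColor_injective hv ((Finset.mem_filter.1 h1).2.trans (Finset.mem_filter.1 h2).2.symm)

theorem segCount_eq_zero {q τ h R s i : ℕ} {j : ℕ × ℕ}
    (hj : ∀ i' < i, roundColor q τ h R s i' ≠ j) : segCount q τ h j R s i = 0 :=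
  Finset.sum_eq_zero fun i' hi' => if_neg (hj i' (Finset.mem_range.1 hi'))

theorem segCount_separator {q τ h R s s₀ i : ℕ} (hv : padicValNat 2 (R + 1) < q * h)
    (hi : i ≤ h) : segCount q τ h (q + 2, s₀) R s i = 0 := by
  refine segCount_eq_zero fun i' hi' heq => ?_
  have hq : padicValNat 2 (R + 1) / h < q := Nat.div_lt_of_lt_mul (by rwa [mul_comm])
  have hq' : s % (q + 1) < q + 1 := Nat.mod_lt _ (Nat.succ_pos q)
  unfold roundColor at heq
  split_ifs at heq <;> simp only [Prod.mk.injEq] at heq <;> omega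

theorem segCount_separator_full {q τ h R s s₀ : ℕ} (hv : padicValNat 2 (R + 1) < q * h) :
    segCount q τ h (q + 2, s₀) R s (h + 1) = if s = s₀ then 1 else 0 := by
  have h1 := segCount_separator (τ := τ) (s := s) (s₀ := s₀) hv (le_refl h)
  rw [segCount] at h1 ⊢
  rw [Finset.sum_range_succ, h1]
  simp [roundColor]

theorem segCount_data {q τ h R v i : ℕ} (hh : 2 ≤ h) (hv : v < q * h) :
    segCount q τ h (v / h, v % h) R ((q + 1) * τ) i =
      if 1 ≤ i ∧ padicValNat 2 (R + 1) = v then 1 else 0 := by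
  have hq : v / h < q := Nat.div_lt_of_lt_mul (by rwa [mul_comm])
  cases i with
  | zero => simp [segCount]
  | succ i =>
    rw [segCount, Finset.sum_range_succ', Finset.sum_eq_zero, zero_add]
    · have h0 : ¬ (0 = h) := by omega
      simp only [roundColor, h0, lt_irrefl, if_false, if_true, Prod.mk.injEq, Nat.le_add_left,
        true_and]
      refine if_congr ⟨fun ⟨h1, h2⟩ => ?_, fun h1 => by rw [h1]; exact ⟨rfl, rfl⟩⟩ rfl rfl
      rw [← Nat.div_add_mod (padicValNat 2 (R + 1)) h, h1, h2, Nat.div_add_mod]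
    · intro i' _
      refine if_neg fun heq => ?_
      unfold roundColor at heq
      split_ifs at heq <;> simp only [Prod.mk.injEq] at heq <;> omega

theorem segCount_parity {q τ h R z : ℕ} (hh : 2 ≤ h) (hv : padicValNat 2 (R + 1) < q * h) :
    segCount q τ h (q, z) R ((q + 1) * τ) (h + 1) =
      if padicValNat 2 (R + 1) % h = z then 1 else 0 := by
  have hq : padicValNat 2 (R + 1) / h < q := Nat.div_lt_of_lt_mul (by rwa [mul_comm])
  obtain ⟨h', rfl⟩ : ∃ h', h = h' + 1 := ⟨h - 1, by omega⟩
  rw [segCount, Finset.sum_range_succ', Finset.sum_range_succ', Finset.sum_eq_zero, zero_add]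
  · have h0 : ¬ (0 = h' + 1) := by omega
    have h1 : h' ≠ 0 := by omega
    simp [roundColor, h1, hq.ne]
  · intro i' _
    refine if_neg fun heq => ?_
    unfold roundColor at heq
    split_ifs at heq <;> simp only [Prod.mk.injEq] at heq <;> omega

theorem segCount_lap {q τ h R s i : ℕ} {j : ℕ × ℕ} (hs : s < (q + 1) * τ)
    (hj : j.1 ≠ s % (q + 1)) (hj' : j.1 ≠ q + 2) : segCount q τ h j R s i = 0 := by
  refine segCount_eq_zero fun i' _ heq => ?_
  rw [roundColor, if_pos hs] at heq
  subst heq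
  split_ifs at hj hj'
  · exact hj' rfl
  · exact hj rfl

theorem padicValNat_lt_of_lt_two_pow {n d : ℕ} (hn : n + 1 < 2 ^ d) :
    padicValNat 2 (n + 1) < d := by
  have := Nat.le_of_dvd (Nat.succ_pos n) (pow_padicValNat_dvd (p := 2) (n := n + 1))
  exact (Nat.pow_lt_pow_iff_right (by norm_num)).1 (this.trans_lt hn)

theorem lapCount_le {q τ h : ℕ} (j : ℕ × ℕ) (hτ : 1 ≤ τ) (hqh : 0 < q * h) :
    lapCount q τ h j ((q + 1) * τ) ≤ τ := by
  have hv : padicValNat 2 (0 + 1) < q * h := by simpa using hqh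
  by_cases hj : j.1 = q + 2
  · obtain ⟨b, z⟩ := j
    obtain rfl : b = q + 2 := hj
    simp only [lapCount, segCount_separator_full hv, Finset.sum_ite_eq']
    split_ifs <;> omega
  · calc lapCount q τ h j ((q + 1) * τ)
        ≤ ∑ s ∈ Finset.range (τ * (q + 1) + 0), if s % (q + 1) = j.1 then 1 else 0 := by
          rw [lapCount, mul_comm τ, add_zero]
          refine Finset.sum_le_sum fun s hs => ?_
          split_ifs with hjs
          · exact segCount_le_one j hv
          · exact (segCount_lap (Finset.mem_range.1 hs) (Ne.symm hjs) hj).le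
      _ ≤ ∑ u ∈ Finset.range τ, 1 := by
          rw [Finset.sum_range_mul_add_eq, Finset.sum_range_zero, add_zero]
          refine Finset.sum_le_sum fun u _ => ?_
          rw [← Finset.card_filter, Finset.card_le_one]
          intro i hi i' hi'
          rw [Finset.mem_filter, Finset.mem_range, mul_comm, Nat.mul_add_mod] at hi hi'
          rw [Nat.mod_eq_of_lt hi.1] at hi
          rw [Nat.mod_eq_of_lt hi'.1] at hi'
          rw [hi.2, hi'.2]
      _ = τ := by simp

theorem card_filter_range_add_card_filter_Ico (P : ℕ → Prop) [DecidablePred P] {p q : ℕ}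
    (hpq : p ≤ q) : ((Finset.range p).filter P).card + ((Finset.Ico p q).filter P).card =
      ((Finset.range q).filter P).card := by
  simp only [Finset.card_filter]
  exact Finset.sum_range_add_sum_Ico _ hpq

theorem exists_round_decomposition (q τ h t : ℕ) : ∃ R s i, s ≤ (q + 1) * τ ∧ i ≤ h ∧
    t = (R * ((q + 1) * τ + 1) + s) * (h + 1) + i := by
  refine ⟨t / (h + 1) / ((q + 1) * τ + 1), t / (h + 1) % ((q + 1) * τ + 1), t % (h + 1),
    Nat.le_of_lt_succ (Nat.mod_lt _ (Nat.succ_pos _)),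
    Nat.le_of_lt_succ (Nat.mod_lt _ (Nat.succ_pos _)), ?_⟩
  rw [Nat.div_add_mod', Nat.div_add_mod']

/-- If an interval contains each colour an even number of times, the separators force its ends to
lie in segments of the same kind, an even number of rounds apart, so that the laps in between cancel.
The data colours of these rounds follow the 2-adic valuation, so one of them occurs an odd number of
times. It can only be compensated inside the block listed at the two ends, but then exactly one data
colour changes modulo 2 for its parity colour, which lies in another block. -/
theorem isOddColoring_roundColoring {q τ h M : ℕ} (hh : 2 ≤ h) (hτ : 1 ≤ τ)
    (hM : M + 1 < 2 ^ (q * h)) :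
    IsOddColoring (M * ((q + 1) * τ + 1) * (h + 1)) (M * (τ + 1)) (roundColoring q τ h) where
  card_le j := by
    have hqh : 0 < q * h := by
      rcases Nat.eq_zero_or_pos (q * h) with h0 | h0
      · rw [h0] at hM; omega
      · exact h0
    have h1 := card_filter_roundColoring (q := q) (τ := τ) (h := h) j M (s := 0) (i := 0)
      (Nat.zero_le _) (Nat.zero_le _)
    rw [add_zero, add_zero] at h1
    have h2 : ∑ R' ∈ Finset.range M, segCount q τ h j R' ((q + 1) * τ) (h + 1) ≤ M := by
      refine (Finset.sum_le_card_nsmul _ _ 1 fun R' hR' => segCount_le_one j ?_).trans (by simp)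
      have := Finset.mem_range.1 hR'
      exact padicValNat_lt_of_lt_two_pow (by omega)
    have h3 := Nat.mul_le_mul_left M (lapCount_le (h := h) j hτ hqh)
    have h4 : lapCount q τ h j 0 = 0 := Finset.sum_range_zero _
    have h5 : segCount q τ h j M 0 0 = 0 := Finset.sum_range_zero _
    rw [h1, h4, h5, Nat.mul_add]
    omega
  exists_odd p Q hpQ hQ := by
    by_contra! hno
    have hval : ∀ R ≤ M, padicValNat 2 (R + 1) < q * h := fun R hR =>
      padicValNat_lt_of_lt_two_pow (by omega)
    obtain ⟨R, s, i, hs, hi, rfl⟩ := exists_round_decomposition q τ h p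
    obtain ⟨R', s', i', hs', hi', rfl⟩ := exists_round_decomposition q τ h Q
    have hR' : R' ≤ M := by
      have h1 : R' * (((q + 1) * τ + 1) * (h + 1)) ≤ M * (((q + 1) * τ + 1) * (h + 1)) := by
        rw [← mul_assoc, ← mul_assoc]
        exact ((Nat.mul_le_mul_right _ (Nat.le_add_right _ _)).trans (Nat.le_add_right _ _)).trans hQ
      exact Nat.le_of_mul_le_mul_right h1 (by positivity)
    have hRR : R ≤ R' := by
      by_contra hlt
      have h1 : (R' + 1) * (((q + 1) * τ + 1) * (h + 1)) ≤ R * (((q + 1) * τ + 1) * (h + 1)) :=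
        Nat.mul_le_mul_right _ (by omega)
      have h2 : s' * (h + 1) ≤ ((q + 1) * τ) * (h + 1) := Nat.mul_le_mul_right _ hs'
      have h3 : (R' * ((q + 1) * τ + 1) + s') * (h + 1) + i' <
          (R' + 1) * (((q + 1) * τ + 1) * (h + 1)) := by
        nlinarith
      have h4 : R * (((q + 1) * τ + 1) * (h + 1)) ≤
          (R * ((q + 1) * τ + 1) + s) * (h + 1) + i := by
        rw [← mul_assoc]
        exact (Nat.mul_le_mul_right _ (Nat.le_add_right _ _)).trans (Nat.le_add_right _ _)
      omega
    have hpar : ∀ j, (R * lapCount q τ h j ((q + 1) * τ) +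
        ∑ R' ∈ Finset.range R, segCount q τ h j R' ((q + 1) * τ) (h + 1) +
        lapCount q τ h j s + segCount q τ h j R s i) % 2 =
        (R' * lapCount q τ h j ((q + 1) * τ) +
        ∑ R' ∈ Finset.range R', segCount q τ h j R' ((q + 1) * τ) (h + 1) +
        lapCount q τ h j s' + segCount q τ h j R' s' i') % 2 := by
      intro j
      have h1 := card_filter_range_add_card_filter_Ico (fun t => roundColoring q τ h t = j) hpQ.le
      rw [card_filter_roundColoring j R hs hi, card_filter_roundColoring j R' hs' hi'] at h1
      obtain ⟨y, hy⟩ := Nat.not_odd_iff_even.1 (hno j)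
      omega
    have hsep : ∀ s₀ ≤ (q + 1) * τ,
        (R + if s₀ < s then 1 else 0) % 2 = (R' + if s₀ < s' then 1 else 0) % 2 := by
      intro s₀ hs₀
      have h1 := hpar (q + 2, s₀)
      have hv0 := hval 0 (Nat.zero_le M)
      have hlap : ∀ s, lapCount q τ h (q + 2, s₀) s = if s₀ < s then 1 else 0 := fun s => by
        simp only [lapCount, segCount_separator_full hv0, Finset.sum_ite_eq', Finset.mem_range]
      have hlast : ∀ R ≤ M, ∑ R' ∈ Finset.range R,
          segCount q τ h (q + 2, s₀) R' ((q + 1) * τ) (h + 1) =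
          R * if (q + 1) * τ = s₀ then 1 else 0 := fun R hR => by
        rw [Finset.sum_congr rfl fun R' hR' => segCount_separator_full
          (hval R' (by have := Finset.mem_range.1 hR'; omega))]
        simp
      rw [hlap, hlap, hlap, hlast R (hRR.trans hR'), hlast R' hR',
        segCount_separator (hval R (hRR.trans hR')) hi, segCount_separator (hval R' hR') hi'] at h1
      rcases hs₀.lt_or_eq with hlt | rfl
      · simpa [hlt, hlt.ne'] using h1
      · simpa using h1
    have hR2 : R % 2 = R' % 2 := by
      have := hsep _ le_rfl
      rwa [if_neg (not_lt.2 hs), if_neg (not_lt.2 hs')] at this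
    obtain rfl : s = s' := by
      by_contra hne
      have := hsep (min s s') ((min_le_left _ _).trans hs)
      split_ifs at this <;> omega
    obtain ⟨y, hy⟩ : ∃ y, R' = R + 2 * y := ⟨(R' - R) / 2, by omega⟩
    have hpar' : ∀ j, (∑ R' ∈ Finset.range R, segCount q τ h j R' ((q + 1) * τ) (h + 1) +
        segCount q τ h j R s i) % 2 =
        (∑ R' ∈ Finset.range R', segCount q τ h j R' ((q + 1) * τ) (h + 1) +
        segCount q τ h j R' s i') % 2 := by
      intro j
      have h1 := hpar j
      have h2 : R' * lapCount q τ h j ((q + 1) * τ) = R * lapCount q τ h j ((q + 1) * τ) +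
        2 * (y * lapCount q τ h j ((q + 1) * τ)) := by rw [hy]; ring
      omega
    rcases Nat.eq_zero_or_pos y with rfl | hy0
    · obtain rfl : R' = R := by omega
      have hii : i < i' := by omega
      have h1 := hpar' (roundColor q τ h R' s i)
      rw [segCount_roundColor (hval R' hR'), segCount_roundColor (hval R' hR'), if_pos hii,
        if_neg (lt_irrefl i)] at h1
      omega
    have hdata : ∀ v < q * h, ∀ R, ∑ R' ∈ Finset.range R,
        segCount q τ h (v / h, v % h) R' ((q + 1) * τ) (h + 1) =
        ((Finset.range R).filter fun n => padicValNat 2 (n + 1) = v).card := fun v hv R => by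
      rw [Finset.card_filter]
      refine Finset.sum_congr rfl fun R' _ => ?_
      rw [segCount_data hh hv]
      simp
    rcases hs.lt_or_eq with hlt | rfl
    · -- The ends lie in segments listing block `s % (q + 1)`.
      have heven : ∀ v < q * h, v / h ≠ s % (q + 1) →
          Even ((Finset.Ico R R').filter fun n => padicValNat 2 (n + 1) = v).card := by
        intro v hv hvs
        have hq : v / h < q := Nat.div_lt_of_lt_mul (by rwa [mul_comm])
        have h1 := hpar' (v / h, v % h)
        rw [segCount_lap hlt hvs (by simp only; omega), segCount_lap hlt hvs (by simp only; omega),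
          hdata v hv, hdata v hv] at h1
        have h2 := card_filter_range_add_card_filter_Ico (fun n => padicValNat 2 (n + 1) = v) hRR
        rw [Nat.even_iff]
        omega
      obtain ⟨v, hv1⟩ := exists_card_filter_padicValNat_eq_one (show R < R' by omega)
      have hv : v < q * h := by
        obtain ⟨n, hn⟩ := Finset.card_pos.1 (by rw [hv1]; exact Nat.one_pos)
        rw [Finset.mem_filter, Finset.mem_Ico] at hn
        rw [← hn.2]
        exact hval n (by omega)
      have hvs : v / h = s % (q + 1) := by
        by_contra hvs
        have := heven v hv hvs
        rw [hv1] at this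
        exact absurd this (by decide)
      have hq : v / h < q := Nat.div_lt_of_lt_mul (by rwa [mul_comm])
      have hparity : ∀ R ≤ M, ∑ R' ∈ Finset.range R,
          segCount q τ h (q, v % h) R' ((q + 1) * τ) (h + 1) =
          ((Finset.range R).filter fun n => padicValNat 2 (n + 1) % h = v % h).card :=
        fun R hR => by
          rw [Finset.card_filter]
          refine Finset.sum_congr rfl fun R' hR' => segCount_parity hh (hval R' ?_)
          have := Finset.mem_range.1 hR'
          omega
      have h1 := hpar' (q, v % h)
      rw [segCount_lap hlt (by simp only; omega) (by simp only; omega),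
        segCount_lap hlt (by simp only; omega) (by simp only; omega),
        hparity R (hRR.trans hR'), hparity R' hR'] at h1
      have h2 := card_filter_range_add_card_filter_Ico
        (fun n => padicValNat 2 (n + 1) % h = v % h) hRR
      have h3 : ((Finset.Ico R R').filter fun n => padicValNat 2 (n + 1) % h = v % h).card =
          ∑ u ∈ (Finset.range (q * h)).filter (fun u => u % h = v % h),
            ((Finset.Ico R R').filter fun n => padicValNat 2 (n + 1) = u).card := by
        rw [Finset.card_eq_sum_card_fiberwise (f := fun n => padicValNat 2 (n + 1))
          (t := (Finset.range (q * h)).filter (fun u => u % h = v % h))]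
        · refine Finset.sum_congr rfl fun u hu => ?_
          rw [Finset.filter_filter]
          congr 1
          refine Finset.filter_congr fun n _ => ⟨fun hn => hn.2, fun hn => ⟨?_, hn⟩⟩
          rw [hn]
          exact (Finset.mem_filter.1 hu).2
        · intro n hn
          obtain ⟨hn1, hn2⟩ := Finset.mem_filter.1 hn
          have := Finset.mem_Ico.1 hn1
          exact Finset.mem_filter.2 ⟨Finset.mem_range.2 (hval n (by omega)), hn2⟩
      have hvmem : v ∈ (Finset.range (q * h)).filter (fun u => u % h = v % h) :=
        Finset.mem_filter.2 ⟨Finset.mem_range.2 hv, rfl⟩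
      rw [← Finset.add_sum_erase _ _ hvmem, hv1] at h3
      have h4 : Even (∑ u ∈ ((Finset.range (q * h)).filter (fun u => u % h = v % h)).erase v,
          ((Finset.Ico R R').filter fun n => padicValNat 2 (n + 1) = u).card) := by
        refine Finset.even_sum _ fun u hu => ?_
        rw [Finset.mem_erase, Finset.mem_filter, Finset.mem_range] at hu
        refine heven u hu.2.1 fun hus => hu.1 ?_
        rw [← Nat.div_add_mod u h, ← Nat.div_add_mod v h, hus, hvs, hu.2.2]
      rw [Nat.even_iff] at h4
      omega
    · -- The ends lie in the last segments of their rounds.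
      set R₁ := R + if 1 ≤ i then 1 else 0 with hR₁
      set R₂ := R' + if 1 ≤ i' then 1 else 0 with hR₂
      have hlt : R₁ < R₂ := by split_ifs at hR₁ hR₂ <;> omega
      have hR₂M : R₂ ≤ M + 1 := by split_ifs at hR₂ <;> omega
      obtain ⟨v, hv1⟩ := exists_card_filter_padicValNat_eq_one hlt
      have hv : v < q * h := by
        obtain ⟨n, hn⟩ := Finset.card_pos.1 (by rw [hv1]; exact Nat.one_pos)
        rw [Finset.mem_filter, Finset.mem_Ico] at hn
        rw [← hn.2]
        exact hval n (by omega)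
      have hshift : ∀ R i, ((Finset.range R).filter fun n => padicValNat 2 (n + 1) = v).card +
          segCount q τ h (v / h, v % h) R ((q + 1) * τ) i =
          ((Finset.range (R + if 1 ≤ i then 1 else 0)).filter
            fun n => padicValNat 2 (n + 1) = v).card := by
        intro R i
        rw [segCount_data hh hv]
        by_cases hi1 : 1 ≤ i
        · simp only [hi1, true_and, if_true, Finset.card_filter, Finset.sum_range_succ]
        · simp [hi1]
      have h1 := hpar' (v / h, v % h)
      rw [hdata v hv, hdata v hv, hshift, hshift, ← hR₁, ← hR₂] at h1
      have h2 := card_filter_range_add_card_filter_Ico (fun n => padicValNat 2 (n + 1) = v) hlt.le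
      omega

/-! ### Counting polynomials -/

theorem separatedColoring_mem {h k t : ℕ} (ht : t < k * (h + 1)) :
    separatedColoring h t ∈ ({0} ×ˢ Finset.range h ∪ {1} ×ˢ Finset.range k : Finset (ℕ × ℕ)) := by
  have h1 : t / (h + 1) < k := (Nat.div_lt_iff_lt_mul (Nat.succ_pos h)).2 ht
  have h2 : t % (h + 1) < h + 1 := Nat.mod_lt _ (Nat.succ_pos h)
  unfold separatedColoring
  split_ifs with h3
  · simp [h1]
  · simp only [Finset.mem_union, Finset.mem_product, Finset.mem_singleton, Finset.mem_range,
      true_and]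
    omega

theorem roundColoring_mem {q τ h M t : ℕ} (hh : 2 ≤ h) (hM : M + 1 < 2 ^ (q * h))
    (ht : t < M * ((q + 1) * τ + 1) * (h + 1)) :
    roundColoring q τ h t ∈ (Finset.range (q + 2) ×ˢ Finset.range h ∪
      {q + 2} ×ˢ Finset.range ((q + 1) * τ + 1) : Finset (ℕ × ℕ)) := by
  have h1 : t / (h + 1) / ((q + 1) * τ + 1) < M :=
    (Nat.div_lt_iff_lt_mul (Nat.succ_pos _)).2 ((Nat.div_lt_iff_lt_mul (Nat.succ_pos h)).2 ht)
  have hs : t / (h + 1) % ((q + 1) * τ + 1) < (q + 1) * τ + 1 := Nat.mod_lt _ (Nat.succ_pos _)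
  have hi : t % (h + 1) < h + 1 := Nat.mod_lt _ (Nat.succ_pos h)
  unfold roundColoring
  generalize t / (h + 1) / ((q + 1) * τ + 1) = R at *
  generalize t / (h + 1) % ((q + 1) * τ + 1) = s at *
  generalize t % (h + 1) = i at *
  have hv : padicValNat 2 (R + 1) < q * h := padicValNat_lt_of_lt_two_pow (by omega)
  have hq : padicValNat 2 (R + 1) / h < q := Nat.div_lt_of_lt_mul (by rwa [mul_comm])
  have hz : padicValNat 2 (R + 1) % h < h := Nat.mod_lt _ (by omega)
  have hq' : s % (q + 1) < q + 1 := Nat.mod_lt _ (Nat.succ_pos q)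
  unfold roundColor
  simp only [Finset.mem_union, Finset.mem_product, Finset.mem_singleton, Finset.mem_range]
  split_ifs <;> simp only [true_and] <;> omega

theorem IsOddColoring.number_le {κ : Type*} [DecidableEq κ] {m k : ℕ} {c : ℕ → κ}
    (hc : IsOddColoring m k c) (K : Finset κ) (hK : ∀ i < m, c i ∈ K) (hm : 1 ≤ m) (hk : 1 ≤ k)
    {n : ℕ} (hn : K.card ≤ n) : openNumber m k ≤ n + 1 ∧ closedNumber m k ≤ n + 1 := by
  obtain ⟨h1, h2⟩ := hc.mem_admissible K hK hm hk
  exact ⟨(Nat.sInf_le h1).trans (by omega), (Nat.sInf_le h2).trans (by omega)⟩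

theorem number_le_div_add {m k : ℕ} (hm : 1 ≤ m) (hk : 1 ≤ k) :
    openNumber m k ≤ m / k + k + 1 ∧ closedNumber m k ≤ m / k + k + 1 := by
  have hmk : m ≤ k * (m / k + 1) := by
    rw [mul_comm]
    exact (Nat.lt_mul_of_div_lt (Nat.lt_succ_self _) hk).le
  refine ((isOddColoring_separatedColoring (m / k) k).mono hmk).number_le _
    (fun i hi => separatedColoring_mem (hi.trans_le hmk)) hm hk ?_
  exact (Finset.card_union_le _ _).trans (by simp)

theorem number_le_of_rounds {m k q τ h M : ℕ} (hm : 1 ≤ m) (hk : 1 ≤ k) (hh : 2 ≤ h) (hτ : 1 ≤ τ)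
    (hM : M + 1 < 2 ^ (q * h)) (hmM : m ≤ M * ((q + 1) * τ + 1) * (h + 1))
    (hMk : M * (τ + 1) ≤ k) :
    openNumber m k ≤ (q + 2) * h + ((q + 1) * τ + 1) + 1 ∧
      closedNumber m k ≤ (q + 2) * h + ((q + 1) * τ + 1) + 1 := by
  have hc := (isOddColoring_roundColoring hh hτ hM).mono hmM
  have hc' : IsOddColoring m k (roundColoring q τ h) :=
    ⟨fun j => (hc.card_le j).trans hMk, hc.exists_odd⟩
  refine hc'.number_le _ (fun i hi => roundColoring_mem hh hM (hi.trans_le hmM)) hm hk ?_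
  exact (Finset.card_union_le _ _).trans (by simp)

theorem admissible_nonempty {m k : ℕ} (hm : 1 ≤ m) (hk : 1 ≤ k) :
    (openAdmissible m k).Nonempty ∧ (closedAdmissible m k).Nonempty := by
  have hmk : m ≤ k * (m / k + 1) := by
    rw [mul_comm]
    exact (Nat.lt_mul_of_div_lt (Nat.lt_succ_self _) hk).le
  obtain ⟨h1, h2⟩ := ((isOddColoring_separatedColoring (m / k) k).mono hmk).mem_admissible _
    (fun i hi => separatedColoring_mem (hi.trans_le hmk)) hm hk
  exact ⟨⟨_, h1⟩, ⟨_, h2⟩⟩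

theorem le_number_mul {m k : ℕ} (hm : 1 ≤ m) (hk : 1 ≤ k) :
    m ≤ openNumber m k * k ∧ m ≤ closedNumber m k * k := by
  obtain ⟨h1, h2⟩ := admissible_nonempty hm hk
  obtain ⟨P, hP, hcard⟩ := exists_isPolygon_encard_edges m
  obtain ⟨a, b, h⟩ := hP.exists_isIrredundant_of_encard hcard
  obtain ⟨p, hp, hdeg⟩ := Nat.sInf_mem h1 P hP hcard
  obtain ⟨p', hp', hdeg'⟩ := Nat.sInf_mem h2 P hP hcard
  exact ⟨h.le_mul_of_interior_eq p hdeg hp, h.le_mul_of_eq p' hdeg' hp'⟩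

/-- The round colouring with `M = k / (τ + 1)` rounds and blocks of size `τ ^ 2`. -/
theorem number_le_of_large {m k τ : ℕ} (hτ : 2 ≤ τ) (hm : 2 ≤ m) (hk : (τ + 1) * (τ + 2) ≤ k)
    (hlog : (τ * (2 * τ ^ 2 + τ + 2) : ℝ) ≤ Real.logb 2 m)
    (hkm : (k : ℝ) ≤ m / Real.logb 2 m) :
    (openNumber m k : ℝ) ≤ (1 + 6 / τ) * (m / k) ∧
      (closedNumber m k : ℝ) ≤ (1 + 6 / τ) * (m / k) := by
  have hτ0 : (2 : ℝ) ≤ τ := by exact_mod_cast hτ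
  have hk1 : 1 ≤ k := le_trans (by nlinarith) hk
  have hk0 : (0 : ℝ) < k := by exact_mod_cast hk1
  have hm0 : (2 : ℝ) ≤ m := by exact_mod_cast hm
  set L := Real.logb 2 m with hL
  have hLpos : 0 < L := lt_of_lt_of_le (by positivity) hlog
  have hxL : L ≤ m / k := by
    rw [le_div_iff₀ hLpos] at hkm
    rw [le_div_iff₀ hk0]
    linarith
  set x : ℝ := m / k with hx
  set M := k / (τ + 1) with hMdef
  have hMk : M * (τ + 1) ≤ k := Nat.div_mul_le_self _ _
  have hM1 : τ + 2 ≤ M := (Nat.le_div_iff_mul_le (Nat.succ_pos τ)).2 (by rwa [mul_comm])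
  have hkM : k ≤ M * (τ + 2) := by
    have := Nat.div_add_mod k (τ + 1)
    have h2 : k % (τ + 1) < τ + 1 := Nat.mod_lt _ (Nat.succ_pos τ)
    rw [← hMdef] at this
    nlinarith
  have hM0 : (0 : ℝ) < M := by exact_mod_cast (show 0 < M by omega)
  set q := m / (τ * τ ^ 2 * M) with hq
  have hden : 0 < τ * τ ^ 2 * M := by
    have : 0 < M := by omega
    positivity
  have hq1 : m < (q + 1) * (τ * τ ^ 2 * M) := Nat.lt_mul_of_div_lt (Nat.lt_succ_self _) hden
  have hq2 : q * (τ * τ ^ 2 * M) ≤ m := Nat.div_mul_le_self _ _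
  have hq1' : (m : ℝ) < (q + 1) * (τ * τ ^ 2 * M) := by exact_mod_cast hq1
  have hq2' : (q : ℝ) * (τ * τ ^ 2 * M) ≤ m := by exact_mod_cast hq2
  have hMk' : (M : ℝ) * (τ + 1) ≤ k := by exact_mod_cast hMk
  have hkM' : (k : ℝ) ≤ M * (τ + 2) := by exact_mod_cast hkM
  have hxk : x * k = m := div_mul_cancel₀ _ hk0.ne'
  have hx0 : 0 < x := by positivity
  -- `q * h` is at least `(1 + 1 / τ) * x - h`.
  have hqh : x * (τ + 1) ≤ (q + 1) * τ ^ 2 * τ := by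
    have h1 : x * (M * (τ + 1)) ≤ x * k := by gcongr
    have h2 : M * (x * (τ + 1)) ≤ M * ((q + 1) * τ ^ 2 * τ) := by linarith
    exact le_of_mul_le_mul_left h2 hM0
  have hqh' : L + 1 ≤ q * τ ^ 2 := by
    have h1 : L * (τ + 1) ≤ (q + 1) * τ ^ 2 * τ :=
      le_trans (by gcongr) hqh
    have h2 : (L + 1) * τ ≤ q * τ ^ 2 * τ := by nlinarith
    exact le_of_mul_le_mul_right h2 (by linarith)
  have hpow : M + 1 < 2 ^ (q * τ ^ 2) := by
    have h1 : (m : ℝ) * 2 ≤ 2 ^ (q * τ ^ 2) := by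
      have h2 : Real.logb 2 (m * 2) ≤ ((q * τ ^ 2 : ℕ) : ℝ) := by
        rw [Real.logb_mul (by linarith) (by norm_num), Real.logb_self_eq_one (by norm_num)]
        exact_mod_cast hqh'
      rwa [Real.logb_le_iff_le_rpow (by norm_num) (by linarith), Real.rpow_natCast] at h2
    have h2 : m * 2 ≤ 2 ^ (q * τ ^ 2) := by exact_mod_cast h1
    have h3 : k ≤ m := by
      have h4 : (1 : ℝ) ≤ L := le_trans (by nlinarith) hlog
      have h5 : (k : ℝ) ≤ m := hkm.trans (div_le_self (by linarith) h4)
      exact_mod_cast h5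
    nlinarith
  have hmM : m ≤ M * ((q + 1) * τ + 1) * (τ ^ 2 + 1) := by
    refine hq1.le.trans ?_
    calc (q + 1) * (τ * τ ^ 2 * M) = M * ((q + 1) * τ) * τ ^ 2 := by ring
      _ ≤ M * ((q + 1) * τ + 1) * (τ ^ 2 + 1) := by gcongr <;> omega
  have hbound : (((q + 2) * τ ^ 2 + ((q + 1) * τ + 1) + 1 : ℕ) : ℝ) ≤ (1 + 6 / τ) * x := by
    have h1 : (q : ℝ) * τ ^ 3 ≤ x * (τ + 2) := by
      have h2 : x * k ≤ x * (M * (τ + 2)) := by gcongr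
      have h3 : M * ((q : ℝ) * τ ^ 3) ≤ M * (x * (τ + 2)) := by linarith
      exact le_of_mul_le_mul_left h3 hM0
    have h2 : (τ * (2 * τ ^ 2 + τ + 2) : ℝ) ≤ x := hlog.trans hxL
    have h3 : (q : ℝ) * (τ ^ 2 + τ) ≤ (1 + 4 / τ) * x := by
      have h4 : (q : ℝ) * τ ^ 3 * (τ + 1) ≤ x * (τ + 2) * (τ + 1) := by gcongr
      have h5 : x * (τ + 2) * (τ + 1) ≤ x * (τ ^ 2 + 4 * τ) := by
        rw [mul_assoc]
        gcongr
        nlinarith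
      have h6 : (1 + 4 / τ) * x = x * (τ ^ 2 + 4 * τ) / τ ^ 2 := by
        field_simp
      rw [h6, le_div_iff₀ (by positivity)]
      linarith
    have h4 : (2 * τ ^ 2 + τ + 2 : ℝ) ≤ 1 / τ * x := by
      rw [one_div, ← div_eq_inv_mul, le_div_iff₀ (by linarith)]
      linarith
    have h5 : (1 + 6 / τ) * x = (1 + 4 / τ) * x + 1 / τ * x + 1 / τ * x := by ring
    have h6 : 0 ≤ 1 / τ * x := by positivity
    push_cast
    rw [h5]
    linarith
  obtain ⟨h1, h2⟩ := number_le_of_rounds (m := m) (k := k) (by omega) hk1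
    (show 2 ≤ τ ^ 2 by nlinarith) (by omega) hpow hmM hMk
  exact ⟨le_trans (by exact_mod_cast h1) hbound, le_trans (by exact_mod_cast h2) hbound⟩

theorem number_le_of_small {m k τ : ℕ} (hτ : 1 ≤ τ) (hk : 1 ≤ k) (hk' : k < (τ + 1) * (τ + 2))
    (hm : τ * ((τ + 1) * (τ + 2)) * ((τ + 1) * (τ + 2)) ≤ m) :
    (openNumber m k : ℝ) ≤ (1 + 6 / τ) * (m / k) ∧
      (closedNumber m k : ℝ) ≤ (1 + 6 / τ) * (m / k) := by
  have hτ0 : (0 : ℝ) < τ := by exact_mod_cast hτ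
  have hk0 : (0 : ℝ) < k := by exact_mod_cast hk
  have hm1 : 1 ≤ m := le_trans (Nat.succ_le_of_lt (by positivity)) hm
  have hmk : τ * (k + 1) * k ≤ m := by
    refine le_trans ?_ hm
    gcongr
    exact hk'
  have h1 : (k : ℝ) + 1 ≤ 1 / τ * (m / k) := by
    have h2 : (τ : ℝ) * (k + 1) * k ≤ m := by exact_mod_cast hmk
    rw [one_div, ← div_eq_inv_mul, le_div_iff₀ hτ0, le_div_iff₀ hk0]
    linarith
  have hbound : ((m / k + k + 1 : ℕ) : ℝ) ≤ (1 + 6 / τ) * (m / k) := by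
    have h2 : ((m / k : ℕ) : ℝ) ≤ m / k := Nat.cast_div_le
    have h3 : (1 + 6 / τ) * (m / k : ℝ) = m / k + 1 / τ * (m / k) + 5 * (1 / τ * (m / k)) := by ring
    push_cast
    rw [h3]
    have : (0 : ℝ) ≤ 1 / τ * (m / k) := by positivity
    linarith
  obtain ⟨h2, h3⟩ := number_le_div_add hm1 hk
  exact ⟨le_trans (by exact_mod_cast h2) hbound, le_trans (by exact_mod_cast h3) hbound⟩

open Filter in
theorem eventually_number_le {δ : ℝ} (hδ : 0 < δ) :
    ∀ᶠ m : ℕ in atTop, ∀ k : ℕ, 1 ≤ k → (k : ℝ) ≤ m / Real.logb 2 m →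
      (openNumber m k : ℝ) ≤ (1 + δ) * (m / k) ∧ (closedNumber m k : ℝ) ≤ (1 + δ) * (m / k) := by
  obtain ⟨τ, hτ⟩ := exists_nat_ge (max 2 (6 / δ))
  have hτ2 : 2 ≤ τ := by exact_mod_cast (le_max_left _ _).trans hτ
  have hτ0 : (0 : ℝ) < τ := by exact_mod_cast (show 0 < τ by omega)
  have hτδ : 6 / (τ : ℝ) ≤ δ := by
    have := (le_max_right _ _).trans hτ
    rw [div_le_iff₀ hδ] at this
    rw [div_le_iff₀ hτ0]
    linarith
  have hlog : Tendsto (fun m : ℕ => Real.logb 2 m) atTop atTop :=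
    (Real.tendsto_logb_atTop (by norm_num)).comp tendsto_natCast_atTop_atTop
  filter_upwards [hlog.eventually_ge_atTop (τ * (2 * τ ^ 2 + τ + 2) : ℝ),
    eventually_ge_atTop 2,
    eventually_ge_atTop (τ * ((τ + 1) * (τ + 2)) * ((τ + 1) * (τ + 2)))] with m h1 h2 h3 k hk hkm
  have hmono : (1 + 6 / τ) * (m / k : ℝ) ≤ (1 + δ) * (m / k) := by gcongr
  rcases lt_or_ge k ((τ + 1) * (τ + 2)) with hlt | hge
  · obtain ⟨h4, h5⟩ := number_le_of_small (by omega) hk hlt h3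
    exact ⟨h4.trans hmono, h5.trans hmono⟩
  · obtain ⟨h4, h5⟩ := number_le_of_large hτ2 h2 hge h1 hkm
    exact ⟨h4.trans hmono, h5.trans hmono⟩

open Filter in
theorem exists_tendsto_zero_number_le :
    ∃ ε : ℕ → ℝ, Tendsto ε atTop (nhds 0) ∧ ∀ m k : ℕ, 2 ≤ m → 1 ≤ k →
      (k : ℝ) ≤ m / Real.logb 2 m →
      (openNumber m k : ℝ) ≤ (1 + ε m) * (m / k) ∧
        (closedNumber m k : ℝ) ≤ (1 + ε m) * (m / k) := by
  classical
  -- The largest relative excess over all admissible `k`, of which there are finitely many.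
  set e : ℕ → ℕ → ℝ := fun m k => if 1 ≤ k ∧ (k : ℝ) ≤ m / Real.logb 2 m then
    max 0 (max (openNumber m k : ℝ) (closedNumber m k) / (m / k) - 1) else 0 with he
  have he0 : ∀ m k, 0 ≤ e m k := fun m k => by
    simp only [he]
    split_ifs
    · exact le_max_left _ _
    · exact le_rfl
  have hbdd : ∀ m, BddAbove (Set.range fun k : Fin (m + 1) => e m k) := fun m =>
    (Set.finite_range _).bddAbove
  refine ⟨fun m => ⨆ k : Fin (m + 1), e m k, ?_, fun m k hm hk hkm => ?_⟩
  · rw [Metric.tendsto_atTop']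
    intro δ hδ
    have hδ2 : 0 < δ / 2 := by linarith
    obtain ⟨N, hN⟩ := eventually_atTop.1 (eventually_number_le hδ2)
    refine ⟨N + 1, fun m hm => ?_⟩
    have hm0 : (0 : ℝ) < m := by exact_mod_cast (show 0 < m by omega)
    have hle : ⨆ k : Fin (m + 1), e m k ≤ δ / 2 := by
      refine ciSup_le fun k => ?_
      simp only [he]
      split_ifs with hk
      · obtain ⟨h1, h2⟩ := hN m (by omega) k hk.1 hk.2
        have hk0 : (0 : ℝ) < (k : ℕ) := by exact_mod_cast hk.1
        refine max_le hδ2.le ?_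
        rw [sub_le_iff_le_add, div_le_iff₀ (by positivity), add_comm (δ / 2)]
        exact max_le h1 h2
      · exact hδ2.le
    have hge : 0 ≤ ⨆ k : Fin (m + 1), e m k := (he0 m _).trans (le_ciSup (hbdd m) 0)
    rw [Real.dist_eq, sub_zero, abs_of_nonneg hge]
    linarith
  · have hm0 : (2 : ℝ) ≤ m := by exact_mod_cast hm
    have hk0 : (0 : ℝ) < k := by exact_mod_cast hk
    have hlog : 1 ≤ Real.logb 2 m := by
      rw [Real.le_logb_iff_rpow_le (by norm_num) (by linarith), Real.rpow_one]
      exact hm0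
    have hkm' : k ≤ m := by
      have : (k : ℝ) ≤ m := hkm.trans (div_le_self (by linarith) hlog)
      exact_mod_cast this
    have h1 : e m k ≤ ⨆ k : Fin (m + 1), e m k :=
      le_ciSup (f := fun k : Fin (m + 1) => e m k) (hbdd m) ⟨k, Nat.lt_succ_of_le hkm'⟩
    have h2 : max (openNumber m k : ℝ) (closedNumber m k) / (m / k) - 1 ≤ e m k := by
      simp only [he]
      rw [if_pos ⟨hk, hkm⟩]
      exact le_max_right _ _
    have h3 : max (openNumber m k : ℝ) (closedNumber m k) ≤
        (1 + ⨆ k : Fin (m + 1), e m k) * (m / k) := by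
      rw [← div_le_iff₀ (by positivity)]
      linarith
    exact ⟨(le_max_left _ _).trans h3, (le_max_right _ _).trans h3⟩

/-- The two `Nonempty` conjuncts say that the minima defining `openNumber m k` and `closedNumber m k`
exist. -/
theorem theorem1p1 :
    (∀ m k : ℕ, 1 ≤ m → 1 ≤ k →
      (openAdmissible m k).Nonempty ∧ (closedAdmissible m k).Nonempty) ∧
    ∃ ε : ℕ → ℝ, Filter.Tendsto ε Filter.atTop (nhds 0) ∧
      ∀ m k : ℕ, 2 ≤ m → 1 ≤ k → (k : ℝ) ≤ (m : ℝ) / Real.logb 2 (m : ℝ) →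
        ((m : ℝ) / (k : ℝ) ≤ (openNumber m k : ℝ) ∧
          (openNumber m k : ℝ) ≤ (1 + ε m) * ((m : ℝ) / (k : ℝ))) ∧
        ((m : ℝ) / (k : ℝ) ≤ (closedNumber m k : ℝ) ∧
          (closedNumber m k : ℝ) ≤ (1 + ε m) * ((m : ℝ) / (k : ℝ))) := by
  refine ⟨fun m k => admissible_nonempty, ?_⟩
  obtain ⟨ε, hε, hle⟩ := exists_tendsto_zero_number_le
  refine ⟨ε, hε, fun m k hm hk hkm => ?_⟩
  obtain ⟨h1, h2⟩ := hle m k hm hk hkm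
  have hk0 : (0 : ℝ) < k := by exact_mod_cast hk
  obtain ⟨h3, h4⟩ := le_number_mul (m := m) (by omega) hk
  refine ⟨⟨?_, h1⟩, ⟨?_, h2⟩⟩
  · rw [div_le_iff₀ hk0]
    exact_mod_cast h3
  · rw [div_le_iff₀ hk0]
    exact_mod_cast h4
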